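/- Let $a\in C([0,1])\cap C^1(]0,1])$ satisfy $a(0)=0$, $a>0$ on $]0,1]$, $\mu_a:=\sup_{0<x\le 1}\frac{x|a'(x)|}{a(x)}<2$ and $a\in C^{[\mu_a]}([0,1])$, where $[\cdot]$ is the integer part. Put $C_a=\frac1{a(1)}\min\{4,\frac1{2-\mu_a}\}$. Let $V^1_a(0,1)$ be the space of all $u\in L^2(0,1)$ that are locally absolutely continuous in $]0,1]$ with $\sqrt a\,u'\in L^2(0,1)$. Let $H^1_a(0,1)$ be the space of all $u\in V^1_a(0,1)$ with $u(1)=0$ and, if $\mu_a<1$, also $u(0)=0$, normed by $(\int_0^1 a|u'|^2dx)^{1/2}$. Let $H^2_a(0,1)$ be the space of all $u\in H^1_a(0,1)$ with $au'\in H^1(0,1)$. On $\mathcal H_0=H^1_a(0,1)\times L^2(0,1)$, with scalar product $\langle (u,v),(\tilde u,\tilde v)\rangle=\int_0^1(v\tilde v+a u'\tilde u')dx$, let $A(u,v)=(v,(au')')$ with domain $D(A)=H^2_a(0,1)\times H^1_a(0,1)$, and let $e^{tA}$ be the strongly continuous contraction semigroup generated by $A$. A function $u\in C^1([0,\infty[;L^2(0,1))\cap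 C([0,\infty[;H^1_a(0,1))$ is the mild solution, with initial data $(u_0,u_1)\in\mathcal H_0$, of $$u_{tt}-(a(x)u_x)_x=0 \ \text{ in } ]0,\infty[\times]0,1[,\qquad u(t,1)=0,\qquad \begin{cases}u(t,0)=0&\text{if }\mu_a\in[0,1[,\\ \lim_{x\downarrow0}a(x)u_x(t,x)=0&\text{if }\mu_a\in[1,2[,\end{cases}$$ if $(u(t),u_t(t))=e^{tA}(u_0,u_1)$ for all $t\ge0$; it is classical if $(u_0,u_1)\in D(A)$. Its energy is $E_u(t)=\frac12\int_0^1(u_t^2+a\,u_x^2)(t,x)\,dx$. For a mild solution, $u_x(\cdot,1)$ denotes the limit in $L^2(0,T)$, for every $T\ge 0$, of the normal derivatives $u^n_x(\cdot,1)$ of classical solutions $u^n$ whose initial data converge to $(u_0,u_1)$ in $\mathcal H_0$. **Theorem.** For every mild solution $u$, the trace $u_x(\cdot,1)$ exists and belongs to $L^2(0,T)$ for every $T\ge0$, and for every $T\ge 0$ $$a(1)\int_0^T u_x(t,1)^2\,dt\ \ge\ \Big\{(2-\mu_a)T-\frac{4}{\min\{1,a(1)\}}-2\mu_a\sqrt{C_a}\Big\}E_u(0).$$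 Call $C>0$ an observability constant in time $T$ if $\int_0^T u_x(t,1)^2\,dt\ge C\,E_u(0)$ for all mild solutions $u$, call the equation observable in time $T$ if such a constant exists, and let $C_T$ be the supremum of all observability constants in time $T$. Then for every $$T>T_a:=\frac1{2-\mu_a}\Big(\frac4{\min\{1,a(1)\}}+2\mu_a\sqrt{C_a}\Big)$$ the equation is observable in time $T$, and $$C_T\ \ge\ \frac1{a(1)}\Big\{(2-\mu_a)T-\frac4{\min\{1,a(1)\}}-2\mu_a\sqrt{C_a}\Big\}.$$ -/

import Mathlib

open MeasureTheory Set Filter Topology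

namespace DegWave

noncomputable section

/-! ### The diffusion coefficient -/

/-- The degeneracy parameter `μ_a = sup_{0 < x ≤ 1} x |a'(x)| / a(x)`; the derivative at `x = 1` is
the one-sided one. -/
def mu (a : ℝ → ℝ) : ℝ :=
  sSup ((fun x : ℝ => x * |derivWithin a (Ioc 0 1) x| / a x) '' Ioc 0 1)

/-- The standing assumptions on the coefficient: `a ∈ C([0,1]) ∩ C¹(]0,1])`, `a > 0` on `]0,1]`,
`a(0) = 0`, `μ_a < 2` (with `μ_a` a genuine supremum) and `a ∈ C^{[μ_a]}([0,1])`. -/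
structure IsDegenerateCoeff (a : ℝ → ℝ) : Prop where
  continuousOn : ContinuousOn a (Icc 0 1)
  contDiffOn : ContDiffOn ℝ 1 a (Ioc 0 1)
  pos : ∀ x ∈ Ioc (0 : ℝ) 1, 0 < a x
  zero : a 0 = 0
  bddAbove : BddAbove ((fun x : ℝ => x * |derivWithin a (Ioc 0 1) x| / a x) '' Ioc 0 1)
  mu_lt_two : mu a < 2
  contDiffOn_floor : ContDiffOn ℝ ((⌊mu a⌋₊ : ℕ) : WithTop ℕ∞) a (Icc 0 1)

/-- The constant `C_a = (1 / a(1)) min {4, 1 / (2 - μ_a)}`. -/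
def poincareConst (a : ℝ → ℝ) : ℝ := 1 / a 1 * min 4 (1 / (2 - mu a))

/-! ### Function spaces -/

/-- Lebesgue measure on the interval `(0,1)`. -/
abbrev vol01 : Measure ℝ := volume.restrict (Ioo 0 1)

/-- The space `L²(0,1)`. -/
abbrev L2 : Type := Lp ℝ 2 vol01

/-- `f` belongs to `V¹_a(0,1)`: it is in `L²(0,1)`, locally absolutely continuous in `]0,1]`, and
`√a f' ∈ L²(0,1)`. Only the values of `f` on `]0,1]` matter. -/
structure IsV1 (a f : ℝ → ℝ) : Prop where
  memLp : MemLp f 2 vol01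
  ac : ∀ ε ∈ Ioo (0 : ℝ) 1, AbsolutelyContinuousOnInterval f ε 1
  memLp_deriv : MemLp (fun x => √(a x) * deriv f x) 2 vol01

/-- `f` belongs to `H¹_a(0,1)`: it is in `V¹_a(0,1)`, `f(1) = 0` and, in the weakly degenerate case
`μ_a < 1`, moreover `f(0) = 0` (as the value at `0` of the continuous extension). -/
structure IsH1 (a f : ℝ → ℝ) : Prop extends IsV1 a f where
  at_one : f 1 = 0
  at_zero : mu a < 1 → Tendsto f (𝓝[>] 0) (𝓝 0)

lemma ae_differentiableAt_of_ac {f : ℝ → ℝ}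
    (hf : ∀ ε ∈ Ioo (0 : ℝ) 1, AbsolutelyContinuousOnInterval f ε 1) :
    ∀ᵐ x ∂vol01, DifferentiableAt ℝ f x := by
  have h : ∀ n : ℕ, ∀ᵐ x : ℝ, x ∈ uIcc (1 / ((n : ℝ) + 2)) 1 → DifferentiableAt ℝ f x := by
    intro n
    refine (hf _ ⟨by positivity, ?_⟩).ae_differentiableAt
    rw [div_lt_one (by positivity)]
    have : (0 : ℝ) ≤ n := n.cast_nonneg
    linarith
  rw [ae_restrict_iff' measurableSet_Ioo]
  filter_upwards [ae_all_iff.2 h] with x hx hx01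
  obtain ⟨n, hn⟩ := exists_nat_one_div_lt hx01.1
  refine hx n ?_
  have h1 : 1 / ((n : ℝ) + 2) ≤ 1 / ((n : ℝ) + 1) := by
    apply one_div_le_one_div_of_le <;> [positivity; linarith]
  exact mem_uIcc_of_le (h1.trans hn.le) hx01.2.le

lemma IsH1.zero (a : ℝ → ℝ) : IsH1 a (fun _ => 0) where
  memLp := MemLp.zero
  ac ε _ := LipschitzOnWith.absolutelyContinuousOnInterval (K := 0)
    (LipschitzWith.const' (0 : ℝ)).lipschitzOnWith
  memLp_deriv := by simp
  at_one := rfl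
  at_zero _ := tendsto_const_nhds

lemma IsV1.deriv_add {a f g : ℝ → ℝ} (hf : IsV1 a f) (hg : IsV1 a g) :
    (fun x => √(a x) * deriv (f + g) x) =ᵐ[vol01]
      (fun x => √(a x) * deriv f x) + fun x => √(a x) * deriv g x := by
  filter_upwards [ae_differentiableAt_of_ac hf.ac, ae_differentiableAt_of_ac hg.ac] with x h1 h2
  simp [_root_.deriv_add h1 h2, mul_add]

lemma IsV1.deriv_smul {a f : ℝ → ℝ} (c : ℝ) :
    (fun x => √(a x) * deriv (c • f) x) = c • fun x => √(a x) * deriv f x := by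
  funext x
  simp only [Pi.smul_apply, smul_eq_mul, deriv_const_smul_field]
  ring

lemma IsH1.add {a f g : ℝ → ℝ} (hf : IsH1 a f) (hg : IsH1 a g) : IsH1 a (f + g) where
  memLp := hf.memLp.add hg.memLp
  ac ε hε := (hf.ac ε hε).add (hg.ac ε hε)
  memLp_deriv := (memLp_congr_ae (hf.toIsV1.deriv_add hg.toIsV1)).2
    (hf.memLp_deriv.add hg.memLp_deriv)
  at_one := by simp [hf.at_one, hg.at_one]
  at_zero h := by
    have := (hf.at_zero h).add (hg.at_zero h)
    rwa [add_zero] at this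

lemma IsH1.smul {a f : ℝ → ℝ} (c : ℝ) (hf : IsH1 a f) : IsH1 a (c • f) where
  memLp := hf.memLp.const_smul c
  ac ε hε := (hf.ac ε hε).const_mul c
  memLp_deriv := by
    rw [IsV1.deriv_smul]
    exact hf.memLp_deriv.const_smul c
  at_one := by simp [hf.at_one]
  at_zero h := by
    have := (hf.at_zero h).const_mul c
    rwa [mul_zero] at this

/-- `H¹_a(0,1)` as a subspace of `L²(0,1)`. -/
def H1Sub (a : ℝ → ℝ) : Submodule ℝ L2 where
  carrier := {u | ∃ f : ℝ → ℝ, u =ᵐ[vol01] f ∧ IsH1 a f}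
  zero_mem' := ⟨fun _ => 0, Lp.coeFn_zero _ _ _, IsH1.zero a⟩
  add_mem' := by
    rintro u v ⟨f, huf, hf⟩ ⟨g, hvg, hg⟩
    exact ⟨f + g, (Lp.coeFn_add u v).trans (huf.add hvg), hf.add hg⟩
  smul_mem' := by
    rintro c u ⟨f, huf, hf⟩
    exact ⟨c • f, (Lp.coeFn_smul c u).trans (huf.const_smul c), hf.smul c⟩

/-- The space `H¹_a(0,1)`, whose norm (defined below) is `|u|_{1,a} = (∫ a |u'|²)^{1/2}`. -/
def H1 {a : ℝ → ℝ} (_ha : IsDegenerateCoeff a) : Type := ↥(H1Sub a)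

variable {a : ℝ → ℝ} {ha : IsDegenerateCoeff a}

instance : AddCommGroup (H1 ha) := inferInstanceAs (AddCommGroup ↥(H1Sub a))

instance : Module ℝ (H1 ha) := inferInstanceAs (Module ℝ ↥(H1Sub a))

/-- The inclusion `H¹_a(0,1) → L²(0,1)`. -/
def H1.toL2 : H1 ha →ₗ[ℝ] L2 := (H1Sub a).subtype

/-- The representative of `u ∈ H¹_a(0,1)` that is locally absolutely continuous in `]0,1]`; it is
unique on `]0,1]`. -/
def H1.rep (u : H1 ha) : ℝ → ℝ := Classical.choose u.2

lemma H1.toL2_ae_eq (u : H1 ha) : u.toL2 =ᵐ[vol01] u.rep := (Classical.choose_spec u.2).1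

lemma H1.isH1_rep (u : H1 ha) : IsH1 a u.rep := (Classical.choose_spec u.2).2

lemma eqOn_of_ae_eq {f g : ℝ → ℝ} (h : f =ᵐ[vol01] g)
    (hf : ∀ ε ∈ Ioo (0 : ℝ) 1, AbsolutelyContinuousOnInterval f ε 1)
    (hg : ∀ ε ∈ Ioo (0 : ℝ) 1, AbsolutelyContinuousOnInterval g ε 1) : EqOn f g (Ioo 0 1) := by
  have key : ∀ {f : ℝ → ℝ}, (∀ ε ∈ Ioo (0 : ℝ) 1, AbsolutelyContinuousOnInterval f ε 1) →
      ContinuousOn f (Ioo 0 1) := by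
    intro f hf x hx
    have h2 : x / 2 ∈ Ioo (0 : ℝ) 1 := ⟨by linarith [hx.1], by linarith [hx.1, hx.2]⟩
    have h3 := (hf _ h2).continuousOn
    rw [uIcc_of_le h2.2.le] at h3
    exact (h3.continuousAt (Icc_mem_nhds (by linarith [hx.1]) hx.2)).continuousWithinAt
  exact Measure.eqOn_open_of_ae_eq h isOpen_Ioo (key hf) (key hg)

lemma H1.deriv_rep_eq (u : H1 ha) {f : ℝ → ℝ} (hf : IsV1 a f) (h : u.toL2 =ᵐ[vol01] f) :
    EqOn (deriv u.rep) (deriv f) (Ioo 0 1) := by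
  have := eqOn_of_ae_eq (u.toL2_ae_eq.symm.trans h) u.isH1_rep.ac hf.ac
  intro x hx
  exact (this.eventuallyEq_of_mem (isOpen_Ioo.mem_nhds hx)).deriv_eq

/-- The linear map `u ↦ √a u'` from `H¹_a(0,1)` to `L²(0,1)`. -/
def H1.grad : H1 ha →ₗ[ℝ] L2 where
  toFun u := u.isH1_rep.memLp_deriv.toLp _
  map_add' u v := by
    rw [← MemLp.toLp_add, MemLp.toLp_eq_toLp_iff]
    refine EventuallyEq.trans ?_ (u.isH1_rep.toIsV1.deriv_add v.isH1_rep.toIsV1)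
    have h : (u + v).toL2 =ᵐ[vol01] u.rep + v.rep := by
      rw [map_add]
      exact (Lp.coeFn_add _ _).trans (u.toL2_ae_eq.add v.toL2_ae_eq)
    have h' := (u + v).deriv_rep_eq (u.isH1_rep.add v.isH1_rep).toIsV1 h
    filter_upwards [ae_restrict_mem measurableSet_Ioo] with x hx
    rw [h' hx]
  map_smul' c u := by
    simp only [RingHom.id_apply]
    rw [← MemLp.toLp_const_smul, MemLp.toLp_eq_toLp_iff, ← IsV1.deriv_smul]
    have h : (c • u).toL2 =ᵐ[vol01] c • u.rep := by
      rw [map_smul]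
      exact (Lp.coeFn_smul _ _).trans (u.toL2_ae_eq.const_smul c)
    have h' := (c • u).deriv_rep_eq (u.isH1_rep.smul c).toIsV1 h
    filter_upwards [ae_restrict_mem measurableSet_Ioo] with x hx
    rw [h' hx]

lemma H1.grad_ae_eq (u : H1 ha) : u.grad =ᵐ[vol01] fun x => √(a x) * deriv u.rep x :=
  MemLp.coeFn_toLp u.isH1_rep.memLp_deriv

lemma H1.grad_injective : Function.Injective (H1.grad (ha := ha)) := by
  rw [← LinearMap.ker_eq_bot, LinearMap.ker_eq_bot']
  intro u hu
  have h0 : ∀ᵐ x ∂vol01, HasDerivAt u.rep 0 x := by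
    have h1 : (fun x => √(a x) * deriv u.rep x) =ᵐ[vol01] 0 :=
      u.grad_ae_eq.symm.trans (by rw [hu]; exact Lp.coeFn_zero _ _ _)
    filter_upwards [h1, ae_differentiableAt_of_ac u.isH1_rep.ac,
      ae_restrict_mem measurableSet_Ioo] with x hx hd hx01
    have hpos : √(a x) ≠ 0 := (Real.sqrt_pos.2 (ha.pos x ⟨hx01.1, hx01.2.le⟩)).ne'
    have : deriv u.rep x = 0 := by simpa [hpos] using hx
    rw [← this]
    exact hd.hasDerivAt
  have hrep : ∀ x ∈ Ioo (0 : ℝ) 1, u.rep x = 0 := by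
    intro x hx
    have hac := u.isH1_rep.ac x hx
    have h2 : ∀ᵐ y : ℝ, y ∈ uIcc x 1 → HasDerivAt u.rep 0 y := by
      rw [ae_restrict_iff' measurableSet_Ioo] at h0
      have h1 : ∀ᵐ y : ℝ, y ≠ 1 := Measure.ae_ne _ _
      filter_upwards [h0, h1] with y hy hy1 hyx
      rw [uIcc_of_le hx.2.le] at hyx
      exact hy ⟨hx.1.trans_le hyx.1, lt_of_le_of_ne hyx.2 hy1⟩
    obtain ⟨C, hC⟩ := hac.const_of_ae_hasDerivAt_zero h2
    rw [hC x left_mem_uIcc, ← hC 1 right_mem_uIcc, u.isH1_rep.at_one]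
  apply Subtype.ext
  apply Lp.ext
  refine u.toL2_ae_eq.trans (EventuallyEq.trans ?_ (Lp.coeFn_zero _ _ _).symm)
  filter_upwards [ae_restrict_mem measurableSet_Ioo] with x hx
  exact hrep x hx

instance : NormedAddCommGroup (H1 ha) :=
  NormedAddCommGroup.induced (H1 ha) L2 H1.grad H1.grad_injective

instance : NormedSpace ℝ (H1 ha) := NormedSpace.induced ℝ (H1 ha) L2 H1.grad

instance : InnerProductSpace ℝ (H1 ha) where
  inner u v := inner ℝ u.grad v.grad
  norm_sq_eq_re_inner u := norm_sq_eq_re_inner (𝕜 := ℝ) u.grad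
  conj_inner_symm u v := inner_conj_symm u.grad v.grad
  add_left u v w := by rw [map_add, inner_add_left]
  smul_left u v c := by rw [map_smul, inner_smul_left]

lemma H1.inner_def (u v : H1 ha) :
    inner ℝ u v = ∫ x in Ioo 0 1, a x * deriv u.rep x * deriv v.rep x := by
  change inner ℝ u.grad v.grad = _
  rw [L2.inner_def]
  refine integral_congr_ae ?_
  filter_upwards [u.grad_ae_eq, v.grad_ae_eq, ae_restrict_mem measurableSet_Ioo] with x hu hv hx
  have := Real.mul_self_sqrt (ha.pos x ⟨hx.1, hx.2.le⟩).le
  simp only [hu, hv, RCLike.inner_apply, conj_trivial]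
  linear_combination deriv u.rep x * deriv v.rep x * this

/-- The (one-sided) derivative `u_x(1)`; it exists whenever `a u'` is in `H¹(0,1)`. -/
def H1.normalDeriv (u : H1 ha) : ℝ := derivWithin u.rep (Ioc 0 1) 1

/-- The energy space `H¹_a(0,1) × L²(0,1)`, with scalar product
`⟨(u,v),(ũ,ṽ)⟩ = ∫ (v ṽ + a u' ũ')`. -/
abbrev EnergySpace {a : ℝ → ℝ} (ha : IsDegenerateCoeff a) : Type := WithLp 2 (H1 ha × L2)

/-! ### The wave operator and its semigroup -/

/-- `au' ∈ H¹(0,1)` with `(au')' = w`: the function `a u'` has a representative which is absolutely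
continuous on `[0,1]` and whose derivative is `w ∈ L²(0,1)`. -/
def HasFluxDeriv (u : H1 ha) (w : L2) : Prop :=
  ∃ g : ℝ → ℝ, AbsolutelyContinuousOnInterval g 0 1 ∧
    (fun x => a x * deriv u.rep x) =ᵐ[vol01] g ∧ w =ᵐ[vol01] deriv g

/-- The graph of the operator `A(u,v) = (v,(au')')` with domain `D(A) = H²_a(0,1) × H¹_a(0,1)`:
`WaveOp ha U W` says that `U ∈ D(A)` and `AU = W`. -/
def WaveOp {a : ℝ → ℝ} (ha : IsDegenerateCoeff a) (U W : EnergySpace ha) : Prop :=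
  U.snd = W.fst.toL2 ∧ HasFluxDeriv U.fst W.snd

/-- `S` is a strongly continuous contraction semigroup on `X`; only times `t ≥ 0` matter. -/
structure IsContractionSemigroup {X : Type*} [NormedAddCommGroup X] [NormedSpace ℝ X]
    (S : ℝ → X →L[ℝ] X) : Prop where
  zero : S 0 = ContinuousLinearMap.id ℝ X
  add : ∀ s t : ℝ, 0 ≤ s → 0 ≤ t → S (s + t) = (S s).comp (S t)
  norm_le : ∀ t : ℝ, 0 ≤ t → ‖S t‖ ≤ 1
  tendsto : ∀ x : X, Tendsto (fun t => S t x) (𝓝[>] 0) (𝓝 x)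

/-- The infinitesimal generator of `S` is the operator with graph `G`. -/
def IsGenerator {X : Type*} [NormedAddCommGroup X] [NormedSpace ℝ X]
    (S : ℝ → X →L[ℝ] X) (G : X → X → Prop) : Prop :=
  ∀ x y : X, G x y ↔ Tendsto (fun h : ℝ => h⁻¹ • (S h x - x)) (𝓝[>] 0) (𝓝 y)

/-- The time derivative `u_t(t) ∈ L²(0,1)` (one-sided at `t = 0`). -/
def timeDeriv (u : ℝ → H1 ha) (t : ℝ) : L2 := derivWithin (fun s => (u s).toL2) (Ici 0) t

/-- `u ∈ C¹([0,∞[; L²(0,1)) ∩ C([0,∞[; H¹_a(0,1))` is the mild solution with initial data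
`(u₀,u₁) ∈ H¹_a(0,1) × L²(0,1)`: `(u(t),u_t(t)) = e^{tA}(u₀,u₁)` for all `t ≥ 0`, where `e^{tA}` is
the contraction semigroup generated by `A`. -/
structure IsMildSolution {a : ℝ → ℝ} (ha : IsDegenerateCoeff a) (u₀ : H1 ha) (u₁ : L2)
    (u : ℝ → H1 ha) : Prop where
  contDiffOn : ContDiffOn ℝ 1 (fun t => (u t).toL2) (Ici 0)
  continuousOn : ContinuousOn u (Ici 0)
  semigroup : ∃ S : ℝ → EnergySpace ha →L[ℝ] EnergySpace ha,
    IsContractionSemigroup S ∧ IsGenerator S (WaveOp ha) ∧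
      ∀ t : ℝ, 0 ≤ t → WithLp.toLp 2 (u t, timeDeriv u t) = S t (WithLp.toLp 2 (u₀, u₁))

/-- A classical solution: a mild solution with initial data in `D(A)`. -/
def IsClassicalSolution {a : ℝ → ℝ} (ha : IsDegenerateCoeff a) (u₀ : H1 ha) (u₁ : L2)
    (u : ℝ → H1 ha) : Prop :=
  IsMildSolution ha u₀ u₁ u ∧ ∃ W, WaveOp ha (WithLp.toLp 2 (u₀, u₁)) W

/-- The energy `E_u(t) = ½ ∫₀¹ (u_t² + a u_x²) dx`. -/
def energy (u : ℝ → H1 ha) (t : ℝ) : ℝ :=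
  1 / 2 * ∫ x in Ioo 0 1, ((timeDeriv u t x) ^ 2 + a x * (deriv (u t).rep x) ^ 2)

/-- `g = u_x(·,1)` for the mild solution `u` with data `(u₀,u₁)`: `g ∈ L²(0,T)` for all `T`, and `g`
is the limit in `L²(0,T)`, for all `T`, of the normal derivatives at `x = 1` of classical solutions
whose initial data converge to `(u₀,u₁)` in the energy space. -/
structure IsNormalTrace {a : ℝ → ℝ} (ha : IsDegenerateCoeff a) (u₀ : H1 ha) (u₁ : L2)
    (g : ℝ → ℝ) : Prop where
  memLp : ∀ T : ℝ, 0 ≤ T → MemLp g 2 (volume.restrict (Ioc 0 T))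
  approx : ∃ (p : ℕ → H1 ha) (q : ℕ → L2) (v : ℕ → ℝ → H1 ha),
    (∀ n, IsClassicalSolution ha (p n) (q n) (v n)) ∧
    Tendsto p atTop (𝓝 u₀) ∧ Tendsto q atTop (𝓝 u₁) ∧
    ∀ T : ℝ, 0 ≤ T → Tendsto
      (fun n => eLpNorm (fun t => (v n t).normalDeriv - g t) 2 (volume.restrict (Ioc 0 T)))
      atTop (𝓝 0)

/-! ### Observability -/

/-- `C > 0` is an observability constant in time `T`: every mild solution satisfies
`∫₀ᵀ u_x(t,1)² dt ≥ C E_u(0)`. -/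
def IsObservabilityConstant {a : ℝ → ℝ} (ha : IsDegenerateCoeff a) (T C : ℝ) : Prop :=
  0 < C ∧ ∀ (u₀ : H1 ha) (u₁ : L2) (u : ℝ → H1 ha) (g : ℝ → ℝ),
    IsMildSolution ha u₀ u₁ u → IsNormalTrace ha u₀ u₁ g →
      C * energy u 0 ≤ ∫ t in (0 : ℝ)..T, g t ^ 2

/-- The equation is observable in time `T` via the normal derivative at `x = 1`. -/
def IsObservable {a : ℝ → ℝ} (ha : IsDegenerateCoeff a) (T : ℝ) : Prop :=
  ∃ C : ℝ, IsObservabilityConstant ha T C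

/-- The supremum `C_T` of all observability constants in time `T`, in the extended reals. -/
def observabilityConst {a : ℝ → ℝ} (ha : IsDegenerateCoeff a) (T : ℝ) : EReal :=
  sSup ((fun C : ℝ => (C : EReal)) '' {C : ℝ | IsObservabilityConstant ha T C})

/-- The time `T_a = (1 / (2 - μ_a)) (4 / min {1, a(1)} + 2 μ_a √C_a)`. -/
def observabilityTime (a : ℝ → ℝ) : ℝ :=
  1 / (2 - mu a) * (4 / min 1 (a 1) + 2 * mu a * √(poincareConst a))

end

end DegWave

namespace DegWave

/-! ### The coefficient -/

namespace IsDegenerateCoeff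

variable {a : ℝ → ℝ}

/-! The proof is the multiplier method with multiplier `x u_x`. If `g = a u'` is absolutely
continuous and `w = g'`, integrating `(x g² / a)'` over `]0,1[` gives `a(1) u_x(1)² = ∫ (1 - x a'/a)
a u'² + 2 ∫ x u' w`, and `x |a'| ≤ μ_a a` controls the first integral (`IsFlux.multiplier_bounds`).
Along a classical solution, `2 ∫ x u_x u_t` has time derivative `2 ∫ x u_x u_tt - ∫ u_t²`. Adding
`μ_a / 2` times `∫ u u_t`, whose derivative is `∫ u_t² - ∫ a u_x²`, balances kinetic and potential
energy and leaves `(2 - μ_a) E_u` as a lower bound. The energy is conserved because `A` is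
skew-symmetric, so integration over `[0,T]` gives the inequality (`observability_classical`). The
constants `4 / min {1, a(1)}` and `2 μ_a √C_a` bound the two functionals at the end times; they rest
on `a ≥ a(1) x²` and on the Hardy-Poincaré inequalities (`abs_multiplierForm_le`,
`abs_productForm_le`).

The degeneracy matters only for boundary terms at `0`. Each is handled by one principle: a function
`F` with integrable derivative has a limit at `0`, and this limit is `0` if `F / x` is integrable
(`LocAC.tendsto_zero`). In Green's formula the Dirichlet condition serves for `μ_a < 1`; for `μ_a ≥
1` the flux vanishes at `0` automatically (`IsFlux.eq_zero`).

For mild solutions, the same multiplier gives the reverse estimate of the trace by the energy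
(`hidden_regularity_classical`). The domain of the generator being dense, the normal derivatives of
suitable classical solutions form a Cauchy sequence in `L²(0,T)`, and the inequality passes to the
limit. Differentiating orbits on both sides uses vector-valued integrals, hence the completeness of
`H¹_a`. -/

lemma hasDerivAt (ha : IsDegenerateCoeff a) {x : ℝ} (hx : x ∈ Ioo (0 : ℝ) 1) :
    HasDerivAt a (deriv a x) x :=
  ((ha.contDiffOn.differentiableOn one_ne_zero x ⟨hx.1, hx.2.le⟩).differentiableAt
    (Ioc_mem_nhds hx.1 hx.2)).hasDerivAt

lemma pos_one (ha : IsDegenerateCoeff a) : 0 < a 1 := ha.pos 1 ⟨one_pos, le_rfl⟩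

lemma mul_abs_deriv_le (ha : IsDegenerateCoeff a) {x : ℝ} (hx : x ∈ Ioo (0 : ℝ) 1) :
    x * |deriv a x| ≤ mu a * a x := by
  have h := le_csSup ha.bddAbove (mem_image_of_mem _ (Ioo_subset_Ioc_self hx))
  rw [derivWithin_of_mem_nhds (Ioc_mem_nhds hx.1 hx.2)] at h
  exact (div_le_iff₀ (ha.pos x ⟨hx.1, hx.2.le⟩)).1 h

lemma mu_nonneg (ha : IsDegenerateCoeff a) : 0 ≤ mu a := by
  have h := ha.mul_abs_deriv_le (x := 1 / 2) ⟨by norm_num, by norm_num⟩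
  have h2 := ha.pos (1 / 2) ⟨by norm_num, by norm_num⟩
  have h3 : 0 ≤ mu a * a (1 / 2) := le_trans (by positivity) h
  exact nonneg_of_mul_nonneg_left h3 h2

lemma continuousOn_Ioc (ha : IsDegenerateCoeff a) : ContinuousOn a (Ioc 0 1) :=
  ha.contDiffOn.continuousOn

/-- Since `x a' ≤ μ_a a`, the function `a(x) x^(-μ_a)` is nonincreasing; its value at `1` is `a(1)`.
-/
lemma rpow_le (ha : IsDegenerateCoeff a) {x : ℝ} (hx : x ∈ Ioc (0 : ℝ) 1) :
    a 1 * x ^ mu a ≤ a x := by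
  have hd : ∀ y ∈ Ioo (0 : ℝ) 1, HasDerivAt (fun y => a y * y ^ (-mu a))
      (deriv a y * y ^ (-mu a) + a y * (-mu a * y ^ (-mu a - 1))) y := fun y hy =>
    (ha.hasDerivAt hy).mul (Real.hasDerivAt_rpow_const (Or.inl hy.1.ne'))
  have hanti : AntitoneOn (fun y => a y * y ^ (-mu a)) (Ioc 0 1) := by
    refine antitoneOn_of_deriv_nonpos (convex_Ioc 0 1) ?_ ?_ ?_
    · exact ha.continuousOn_Ioc.mul fun y hy =>
        (Real.continuousAt_rpow_const y _ (Or.inl hy.1.ne')).continuousWithinAt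
    · rw [interior_Ioc]
      exact fun y hy => (hd y hy).differentiableAt.differentiableWithinAt
    · rw [interior_Ioc]
      intro y hy
      have h1 : y ^ (-mu a) = y ^ (-mu a - 1) * y := by
        rw [← Real.rpow_add_one hy.1.ne']
        ring_nf
      rw [(hd y hy).deriv, h1]
      have h2 := ha.mul_abs_deriv_le hy
      have h3 : y * deriv a y ≤ y * |deriv a y| :=
        mul_le_mul_of_nonneg_left (le_abs_self _) hy.1.le
      have h4 : 0 < y ^ (-mu a - 1) := Real.rpow_pos_of_pos hy.1 _
      nlinarith
  have h := hanti hx ⟨one_pos, le_rfl⟩ hx.2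
  simp only [Real.one_rpow, mul_one] at h
  have h5 : 0 < x ^ mu a := Real.rpow_pos_of_pos hx.1 _
  calc a 1 * x ^ mu a ≤ a x * x ^ (-mu a) * x ^ mu a := by gcongr
    _ = a x := by rw [mul_assoc, ← Real.rpow_add hx.1]; simp

lemma pow_le (ha : IsDegenerateCoeff a) {k : ℕ} (hk : mu a ≤ k) {x : ℝ}
    (hx : x ∈ Ioc (0 : ℝ) 1) : a 1 * x ^ k ≤ a x := by
  refine le_trans ?_ (ha.rpow_le hx)
  have := ha.pos_one
  gcongr
  rw [← Real.rpow_natCast]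
  exact Real.rpow_le_rpow_of_exponent_ge hx.1 hx.2 hk

lemma sq_le (ha : IsDegenerateCoeff a) {x : ℝ} (hx : x ∈ Ioc (0 : ℝ) 1) :
    a 1 * x ^ 2 ≤ a x :=
  ha.pow_le (by exact_mod_cast ha.mu_lt_two.le) hx

/-- The assumption `a ∈ C^{[μ_a]}([0,1])` enters here: for `1 ≤ μ_a < 2` it makes `a` of class `C¹`
up to `0`, hence Lipschitz, and `a(0) = 0`. -/
lemma exists_le_mul (ha : IsDegenerateCoeff a) (h : 1 ≤ mu a) :
    ∃ K : ℝ, ∀ x ∈ Ioc (0 : ℝ) 1, a x ≤ K * x := by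
  have h1 : ⌊mu a⌋₊ = 1 := by
    rw [Nat.floor_eq_iff ha.mu_nonneg]
    exact ⟨by exact_mod_cast h, by norm_num; exact ha.mu_lt_two⟩
  have h2 := ha.contDiffOn_floor
  rw [h1] at h2
  obtain ⟨K, hK⟩ := ContDiffOn.exists_lipschitzOnWith (by exact_mod_cast h2) (by decide)
    (convex_Icc _ _) isCompact_Icc
  refine ⟨K, fun x hx => ?_⟩
  have h3 := hK.dist_le_mul x ⟨hx.1.le, hx.2⟩ 0 ⟨le_rfl, zero_le_one⟩
  rw [ha.zero, Real.dist_eq, Real.dist_eq, sub_zero, sub_zero, abs_of_pos hx.1] at h3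
  exact (le_abs_self _).trans h3

lemma ac_inv (ha : IsDegenerateCoeff a) {ε : ℝ} (hε : ε ∈ Ioo (0 : ℝ) 1) :
    AbsolutelyContinuousOnInterval (fun x => (a x)⁻¹) ε 1 := by
  have hs : Icc ε 1 ⊆ Ioc (0 : ℝ) 1 := fun x hx => ⟨hε.1.trans_le hx.1, hx.2⟩
  refine ContDiffOn.absolutelyContinuousOnInterval ?_
  rw [uIcc_of_le hε.2.le]
  exact (ha.contDiffOn.mono hs).inv fun x hx => (ha.pos x (hs hx)).ne'

lemma continuousOn_inv_sqrt (ha : IsDegenerateCoeff a) :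
    ContinuousOn (fun x => (√(a x))⁻¹) (Ioc 0 1) :=
  ha.continuousOn_Ioc.sqrt.inv₀ fun x hx => (Real.sqrt_pos.2 (ha.pos x hx)).ne'

end IsDegenerateCoeff

/-! ### Functions that are locally absolutely continuous in `]0,1]` -/

/-- Local absolute continuity in `]0,1]`. -/
abbrev LocAC (f : ℝ → ℝ) : Prop :=
  ∀ ε ∈ Ioo (0 : ℝ) 1, AbsolutelyContinuousOnInterval f ε 1

namespace LocAC

variable {f g F φ : ℝ → ℝ}

lemma mul (hf : LocAC f) (hg : LocAC g) : LocAC (fun x => f x * g x) :=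
  fun ε hε => (hf ε hε).fun_mul (hg ε hε)

lemma sq (hf : LocAC f) : LocAC (fun x => f x ^ 2) := by
  simpa only [pow_two] using hf.mul hf

lemma of_contDiff (hf : ContDiff ℝ 1 f) : LocAC f :=
  fun _ _ => hf.contDiffOn.absolutelyContinuousOnInterval

lemma of_ac (hf : AbsolutelyContinuousOnInterval f 0 1) : LocAC f := fun ε hε =>
  hf.mono (by rw [uIcc_of_le hε.2.le, uIcc_of_le zero_le_one]; exact Icc_subset_Icc_left hε.1.le)

lemma ae_hasDerivAt (hf : LocAC f) : ∀ᵐ x ∂vol01, HasDerivAt f (deriv f x) x := by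
  filter_upwards [ae_differentiableAt_of_ac hf] with x hx using hx.hasDerivAt

lemma integral_eq_sub (hF : LocAC F) (hφ : deriv F =ᵐ[vol01] φ) {x : ℝ}
    (hx : x ∈ Ioo (0 : ℝ) 1) : ∫ y in x..1, φ y = F 1 - F x := by
  rw [← (hF x hx).integral_deriv_eq_sub]
  rw [intervalIntegral.integral_of_le hx.2.le, intervalIntegral.integral_of_le hx.2.le,
    integral_Ioc_eq_integral_Ioo, integral_Ioc_eq_integral_Ioo]
  exact integral_congr_ae (ae_restrict_of_ae_restrict_of_subset (Ioo_subset_Ioo_left hx.1.le)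
    hφ.symm)

lemma tendsto_primitive (hint : Integrable φ vol01) :
    Tendsto (fun x => ∫ y in x..1, φ y) (𝓝[>] 0) (𝓝 (∫ y, φ y ∂vol01)) := by
  have h1 : IntegrableOn φ (uIcc 0 1) := by
    rw [uIcc_of_le zero_le_one, integrableOn_Icc_iff_integrableOn_Ioo]
    exact hint
  have h2 := intervalIntegral.continuousOn_primitive_interval_left h1 0 left_mem_uIcc
  rw [ContinuousWithinAt, intervalIntegral.integral_of_le zero_le_one,
    integral_Ioc_eq_integral_Ioo] at h2
  refine h2.mono_left ?_
  rw [uIcc_of_le zero_le_one]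
  exact nhdsWithin_le_iff.2 (Icc_mem_nhdsGT zero_lt_one)

/-- A locally absolutely continuous function with integrable derivative has a limit at `0`. -/
lemma tendsto_sub_integral (hF : LocAC F) (hφ : deriv F =ᵐ[vol01] φ) (hint : Integrable φ vol01) :
    Tendsto F (𝓝[>] 0) (𝓝 (F 1 - ∫ y, φ y ∂vol01)) := by
  refine (tendsto_const_nhds.sub (tendsto_primitive hint)).congr' ?_
  filter_upwards [Ioo_mem_nhdsGT zero_lt_one] with x hx
  rw [hF.integral_eq_sub hφ hx]
  ring

lemma integral_eq_of_tendsto (hF : LocAC F) (hφ : deriv F =ᵐ[vol01] φ)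
    (hint : Integrable φ vol01) (h0 : Tendsto F (𝓝[>] 0) (𝓝 0)) : ∫ y, φ y ∂vol01 = F 1 := by
  have := tendsto_nhds_unique (hF.tendsto_sub_integral hφ hint) h0
  linarith

/-- If `L ≠ 0`, then `1 / x` is dominated near `0` by a multiple of `|F(x) / x|`, but it is not
integrable there. -/
lemma eq_zero_of_integrable_div {L : ℝ} (hF : Tendsto F (𝓝[>] 0) (𝓝 L))
    (hint : Integrable (fun x => F x / x) vol01) : L = 0 := by
  by_contra hL
  have hL' : 0 < |L| := abs_pos.2 hL
  have h1 : ∀ᶠ x in 𝓝[>] (0 : ℝ), |L| / 2 < |F x| := hF.abs.eventually_const_lt (by linarith)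
  obtain ⟨δ, hδ, h2⟩ := mem_nhdsGT_iff_exists_Ioo_subset.1
    (inter_mem h1 (Ioo_mem_nhdsGT zero_lt_one))
  have hδ0 : (0 : ℝ) < δ := hδ
  have h3 : IntervalIntegrable (fun x : ℝ => x⁻¹) volume 0 δ := by
    rw [intervalIntegrable_iff_integrableOn_Ioo_of_le hδ0.le]
    have h4 : IntegrableOn (fun x => F x / x) (Ioo 0 δ) :=
      IntegrableOn.mono_set hint fun x hx => (h2 hx).2
    refine (h4.norm.const_mul (2 / |L|)).mono' measurable_inv.aestronglyMeasurable.restrict ?_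
    filter_upwards [ae_restrict_mem measurableSet_Ioo] with x hx
    have h5 := (h2 hx).1
    rw [Real.norm_eq_abs, Real.norm_eq_abs, abs_div, abs_inv, div_mul_div_comm,
      ← one_div, div_le_div_iff₀ (abs_pos.2 hx.1.ne') (mul_pos hL' (abs_pos.2 hx.1.ne'))]
    have h6 : |L| / 2 < |F x| := h5
    nlinarith [abs_pos.2 hx.1.ne']
  rw [intervalIntegrable_inv_iff] at h3
  rcases h3 with h3 | h3
  · exact hδ0.ne h3
  · exact h3 left_mem_uIcc

lemma tendsto_zero (hF : LocAC F) (hφ : deriv F =ᵐ[vol01] φ) (hint : Integrable φ vol01)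
    (hdiv : Integrable (fun x => F x / x) vol01) : Tendsto F (𝓝[>] 0) (𝓝 0) := by
  have h := hF.tendsto_sub_integral hφ hint
  rwa [eq_zero_of_integrable_div h hdiv] at h

lemma integral_eq (hF : LocAC F) (hφ : deriv F =ᵐ[vol01] φ)
    (hint : Integrable φ vol01) (hdiv : Integrable (fun x => F x / x) vol01) :
    ∫ y, φ y ∂vol01 = F 1 :=
  hF.integral_eq_of_tendsto hφ hint (hF.tendsto_zero hφ hint hdiv)

end LocAC

variable {a : ℝ → ℝ}

/-! ### Scalar products in `L²(0,1)` -/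

lemma inner_eq_integral {u v : L2} {f g : ℝ → ℝ} (hf : u =ᵐ[vol01] f) (hg : v =ᵐ[vol01] g) :
    inner ℝ u v = ∫ x, f x * g x ∂vol01 := by
  rw [L2.inner_def]
  refine integral_congr_ae ?_
  filter_upwards [hf, hg] with x h1 h2
  simp [h1, h2, mul_comm]

lemma norm_sq_eq_integral {u : L2} {f : ℝ → ℝ} (hf : u =ᵐ[vol01] f) :
    ‖u‖ ^ 2 = ∫ x, f x ^ 2 ∂vol01 := by
  rw [← real_inner_self_eq_norm_sq, inner_eq_integral hf hf]
  simp only [pow_two]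

lemma memLp_of_ae_eq {u : L2} {f : ℝ → ℝ} (hf : u =ᵐ[vol01] f) : MemLp f 2 vol01 :=
  (memLp_congr_ae hf).1 (Lp.memLp u)

lemma ae_vol01 {p : ℝ → Prop} (h : ∀ x ∈ Ioo (0 : ℝ) 1, p x) : ∀ᵐ x ∂vol01, p x := by
  filter_upwards [ae_restrict_mem measurableSet_Ioo] with x hx using h x hx

lemma mul_inv_sqrt_le (ha : IsDegenerateCoeff a) {x : ℝ} (hx : x ∈ Ioo (0 : ℝ) 1) :
    |x * (√(a x))⁻¹| ≤ (√(a 1))⁻¹ := by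
  have h1 := ha.sq_le ⟨hx.1, hx.2.le⟩
  have h2 := Real.sqrt_pos.2 (ha.pos x ⟨hx.1, hx.2.le⟩)
  have h3 := Real.sqrt_pos.2 ha.pos_one
  have h4 := Real.sqrt_le_sqrt h1
  rw [Real.sqrt_mul ha.pos_one.le, Real.sqrt_sq hx.1.le] at h4
  rw [abs_of_pos (mul_pos hx.1 (inv_pos.2 h2)), ← div_eq_mul_inv, div_le_iff₀ h2,
    inv_mul_eq_div, le_div_iff₀ h3]
  linarith

lemma measurable_inv_sqrt (ha : IsDegenerateCoeff a) :
    AEStronglyMeasurable (fun x => (√(a x))⁻¹) vol01 :=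
  (ha.continuousOn_inv_sqrt.mono Ioo_subset_Ioc_self).aestronglyMeasurable measurableSet_Ioo

/-- Boundedness of `x / √a` makes `x u'` the image of `√a u'` under a bounded operator of `L²(0,1)`,
so that pairings with `x u'` are continuous in the energy norm and can be differentiated in time. -/
lemma memLp_weight (ha : IsDegenerateCoeff a) :
    MemLp (fun x => x * (√(a x))⁻¹) ⊤ vol01 :=
  memLp_top_of_bound (aestronglyMeasurable_id.mul (measurable_inv_sqrt ha)) (√(a 1))⁻¹
    (ae_vol01 fun _ hx => mul_inv_sqrt_le ha hx)

/-- Multiplication by `x / √a` on `L²(0,1)`. -/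
noncomputable def weightMul (ha : IsDegenerateCoeff a) : L2 →L[ℝ] L2 :=
  (ContinuousLinearMap.mul ℝ ℝ).holderL vol01 ⊤ 2 2 ((memLp_weight ha).toLp _)

lemma weightMul_ae_eq (ha : IsDegenerateCoeff a) {u : L2} {f : ℝ → ℝ} (hf : u =ᵐ[vol01] f) :
    weightMul ha u =ᵐ[vol01] fun x => x * (√(a x))⁻¹ * f x := by
  have h1 : weightMul ha u =ᵐ[vol01] _ := (ContinuousLinearMap.mul ℝ ℝ).coeFn_holder (r := 2)
    ((memLp_weight ha).toLp _) u
  filter_upwards [h1, (memLp_weight ha).coeFn_toLp, hf] with x h1 h2 h3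
  rw [h1, ContinuousLinearMap.mul_apply', h2, h3]

lemma norm_weightMul_le (ha : IsDegenerateCoeff a) (u : L2) :
    ‖weightMul ha u‖ ^ 2 ≤ 1 / a 1 * ‖u‖ ^ 2 := by
  have h := weightMul_ae_eq ha (EventuallyEq.refl _ (u : ℝ → ℝ))
  rw [norm_sq_eq_integral h, norm_sq_eq_integral (EventuallyEq.refl _ _), ← integral_const_mul]
  refine integral_mono_ae (memLp_of_ae_eq h).integrable_sq
    ((Lp.memLp u).integrable_sq.const_mul _) ?_
  refine ae_vol01 fun x hx => ?_
  have h1 := mul_inv_sqrt_le ha hx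
  have h2 : (x * (√(a x))⁻¹) ^ 2 ≤ 1 / a 1 := by
    rw [← sq_abs]
    calc |x * (√(a x))⁻¹| ^ 2 ≤ (√(a 1))⁻¹ ^ 2 := by gcongr
      _ = 1 / a 1 := by rw [inv_pow, Real.sq_sqrt ha.pos_one.le, one_div]
  simp only [mul_pow _ (u x)]
  gcongr

/-! ### Functions in `V¹_a(0,1)` -/

namespace IsV1

variable {f : ℝ → ℝ}

lemma mul_deriv_eq (ha : IsDegenerateCoeff a) :
    (fun x => x * (√(a x))⁻¹ * (√(a x) * deriv f x)) =ᵐ[vol01] fun x => x * deriv f x := by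
  refine ae_vol01 fun x hx => ?_
  have := (Real.sqrt_pos.2 (ha.pos x ⟨hx.1, hx.2.le⟩)).ne'
  field_simp

lemma memLp_mul_deriv (ha : IsDegenerateCoeff a) (hf : IsV1 a f) :
    MemLp (fun x => x * deriv f x) 2 vol01 := by
  refine (memLp_congr_ae (mul_deriv_eq ha)).1 ?_
  exact memLp_of_ae_eq (weightMul_ae_eq ha hf.memLp_deriv.coeFn_toLp)

lemma integrable_mul_deriv_mul (ha : IsDegenerateCoeff a) (hf : IsV1 a f) :
    Integrable (fun x => x * deriv f x * f x) vol01 :=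
  (hf.memLp_mul_deriv ha).integrable_mul hf.memLp

lemma integrable_mul_sq_div (hf : IsV1 a f) :
    Integrable (fun x => x * f x ^ 2 / x) vol01 := by
  refine hf.memLp.integrable_sq.congr (ae_vol01 fun x hx => ?_)
  have := hx.1.ne'
  field_simp

lemma deriv_mul_sq (hf : IsV1 a f) :
    deriv (fun x => x * f x ^ 2) =ᵐ[vol01] fun x => f x ^ 2 + 2 * (x * deriv f x * f x) := by
  filter_upwards [LocAC.ae_hasDerivAt hf.ac] with x hx
  rw [((hasDerivAt_id' x).fun_mul (hx.fun_pow 2)).deriv]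
  simp
  ring

lemma locAC_mul_sq (hf : IsV1 a f) : LocAC (fun x => x * f x ^ 2) :=
  (LocAC.of_contDiff contDiff_fun_id).mul (LocAC.sq hf.ac)

/-- Both `(x f²)' = f² + 2 x f' f` and `x f² / x = f²` are integrable, because `x f'` is in
`L²(0,1)`. -/
lemma tendsto_mul_sq (ha : IsDegenerateCoeff a) (hf : IsV1 a f) :
    Tendsto (fun x => x * f x ^ 2) (𝓝[>] 0) (𝓝 0) :=
  hf.locAC_mul_sq.tendsto_zero hf.deriv_mul_sq
    (hf.memLp.integrable_sq.add ((hf.integrable_mul_deriv_mul ha).const_mul 2))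
    hf.integrable_mul_sq_div

lemma integral_mul_deriv_mul (ha : IsDegenerateCoeff a) (hf : IsV1 a f) (h1 : f 1 = 0) :
    2 * ∫ x, x * deriv f x * f x ∂vol01 = -∫ x, f x ^ 2 ∂vol01 := by
  have h := hf.locAC_mul_sq.integral_eq hf.deriv_mul_sq
    (hf.memLp.integrable_sq.add ((hf.integrable_mul_deriv_mul ha).const_mul 2))
    hf.integrable_mul_sq_div
  rw [integral_add hf.memLp.integrable_sq ((hf.integrable_mul_deriv_mul ha).const_mul 2),
    integral_const_mul, h1] at h
  linarith

/-- A Poincaré inequality for `μ_a ≤ 1`, from the multiplier `(x + x²) f`. -/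
lemma integral_sq_le (ha : IsDegenerateCoeff a) (hmu : mu a ≤ 1) (hf : IsV1 a f) (h1 : f 1 = 0) :
    ∫ x, f x ^ 2 ∂vol01 ≤ 2 / a 1 * ∫ x, (√(a x) * deriv f x) ^ 2 ∂vol01 := by
  have hφ : deriv (fun x => (1 + x) * (x * f x ^ 2)) =ᵐ[vol01]
      fun x => x * f x ^ 2 + (1 + x) * (f x ^ 2 + 2 * (x * deriv f x * f x)) := by
    filter_upwards [hf.deriv_mul_sq, LocAC.ae_hasDerivAt hf.locAC_mul_sq] with x hx hx2
    rw [(((hasDerivAt_id' x).const_add 1).fun_mul hx2).deriv, hx]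
    simp
  have hb : ∀ {h : ℝ → ℝ} (c : ℝ), Integrable h vol01 →
      Integrable (fun x => (c + x) * h x) vol01 := by
    intro h c hh
    refine hh.bdd_mul (c := |c| + 1) (by fun_prop) (ae_vol01 fun x hx => ?_)
    refine (norm_add_le _ _).trans ?_
    rw [Real.norm_eq_abs, Real.norm_eq_abs, abs_of_pos hx.1]
    linarith [hx.2]
  have i1 : Integrable (fun x => x * f x ^ 2) vol01 := by
    simpa using hb 0 hf.memLp.integrable_sq
  have i2 := hb 1 (hf.memLp.integrable_sq.add ((hf.integrable_mul_deriv_mul ha).const_mul 2))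
  have h := LocAC.integral_eq ((LocAC.of_contDiff (contDiff_const.add contDiff_fun_id)).mul
    hf.locAC_mul_sq) hφ (i1.add i2) (by
      simpa only [mul_div_assoc] using hb 1 hf.integrable_mul_sq_div)
  rw [h1] at h
  -- The integral of `((1 + x) x f²)'` is `0`. Completing the square in its cross term, with cost `2
  -- x f'²`, bounds the integrand from below; `μ_a ≤ 1` gives `x ≤ a / a(1)`.
  have key : ∫ x, (f x ^ 2 - 2 / a 1 * (√(a x) * deriv f x) ^ 2) ∂vol01 ≤ 0 := by
    refine le_trans (integral_mono_ae (hf.memLp.integrable_sq.sub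
      (hf.memLp_deriv.integrable_sq.const_mul _)) (i1.add i2) (ae_vol01 fun x hx => ?_))
      (h.trans (by simp)).le
    have h2 : a 1 * x ^ 1 ≤ a x := ha.pow_le (by exact_mod_cast hmu) ⟨hx.1, hx.2.le⟩
    have h3 : x * deriv f x ^ 2 ≤ 1 / a 1 * (√(a x) * deriv f x) ^ 2 := by
      rw [mul_pow, Real.sq_sqrt (ha.pos x ⟨hx.1, hx.2.le⟩).le, one_div, ← mul_assoc]
      gcongr
      rw [inv_mul_eq_div, le_div_iff₀ ha.pos_one]
      linarith
    have h4 : 0 ≤ x * ((1 + x) / 2 * f x + deriv f x) ^ 2 := mul_nonneg hx.1.le (sq_nonneg _)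
    -- The coefficient of `f²` left after completing the square is at least `1`, since `(1 + x)² ≤
    -- 4`.
    have h5 : 0 ≤ (1 + 2 * x - x * (1 + x) ^ 2 / 2) - 1 := by
      nlinarith [hx.1, hx.2, mul_pos hx.1 (sub_pos.2 hx.2), mul_pos hx.1 hx.1]
    have h6 := mul_nonneg h5 (sq_nonneg (f x))
    simp only [Pi.add_apply]
    rw [show 2 / a 1 = 2 * (1 / a 1) by ring]
    nlinarith
  rw [integral_sub hf.memLp.integrable_sq (hf.memLp_deriv.integrable_sq.const_mul _),
    integral_const_mul] at key
  linarith

end IsV1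

/-! ### The space `H¹_a(0,1)` -/

variable {ha : IsDegenerateCoeff a}

namespace H1

lemma inner_eq_grad (u v : H1 ha) : inner ℝ u v = inner ℝ u.grad v.grad := rfl

lemma norm_eq_grad (u : H1 ha) : ‖u‖ = ‖u.grad‖ := rfl

lemma weightMul_grad_ae_eq (u : H1 ha) :
    weightMul ha u.grad =ᵐ[vol01] fun x => x * deriv u.rep x :=
  (weightMul_ae_eq ha u.grad_ae_eq).trans (IsV1.mul_deriv_eq ha)

lemma two_inner_weightMul_grad (u : H1 ha) :
    2 * inner ℝ (weightMul ha u.grad) u.toL2 = -‖u.toL2‖ ^ 2 := by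
  rw [inner_eq_integral u.weightMul_grad_ae_eq u.toL2_ae_eq, norm_sq_eq_integral u.toL2_ae_eq]
  exact u.isH1_rep.toIsV1.integral_mul_deriv_mul ha u.isH1_rep.at_one

/-- Cauchy-Schwarz in `2 ∫ x u' u = -∫ u²` gives `‖u‖ ≤ 2 ‖x u'‖` in `L²(0,1)`, and `x² ≤ a / a(1)`.
-/
lemma norm_toL2_sq_le_hardy (u : H1 ha) : ‖u.toL2‖ ^ 2 ≤ 4 / a 1 * ‖u‖ ^ 2 := by
  have h1 := u.two_inner_weightMul_grad
  have h2 := abs_real_inner_le_norm (weightMul ha u.grad) u.toL2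
  have h3 := norm_weightMul_le ha u.grad
  rw [← norm_eq_grad] at h3
  have h4 : ‖u.toL2‖ ≤ 2 * ‖weightMul ha u.grad‖ := by
    by_contra! h
    have h5 : 0 < ‖u.toL2‖ := lt_of_le_of_lt (by positivity) h
    nlinarith [neg_abs_le (inner ℝ (weightMul ha u.grad) u.toL2)]
  calc ‖u.toL2‖ ^ 2 ≤ (2 * ‖weightMul ha u.grad‖) ^ 2 := by gcongr
    _ = 4 * ‖weightMul ha u.grad‖ ^ 2 := by ring
    _ ≤ 4 * (1 / a 1 * ‖u‖ ^ 2) := by gcongr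
    _ = 4 / a 1 * ‖u‖ ^ 2 := by ring

lemma poincareConst_nonneg (ha : IsDegenerateCoeff a) : 0 ≤ poincareConst a := by
  have h1 := ha.pos_one
  have h2 : 0 < 2 - mu a := by linarith [ha.mu_lt_two]
  unfold poincareConst
  positivity

/-- The Poincaré inequality in `H¹_a(0,1)`. -/
lemma norm_toL2_sq_le (u : H1 ha) : ‖u.toL2‖ ^ 2 ≤ 4 * poincareConst a * ‖u‖ ^ 2 := by
  have h2 : 0 < 2 - mu a := by linarith [ha.mu_lt_two]
  have h0 := ha.pos_one
  unfold poincareConst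
  rcases le_total (mu a) 1 with h | h
  · have h3 := u.isH1_rep.toIsV1.integral_sq_le ha h u.isH1_rep.at_one
    rw [← norm_sq_eq_integral u.toL2_ae_eq, ← norm_sq_eq_integral u.grad_ae_eq,
      ← norm_eq_grad] at h3
    -- As `μ_a ≥ 0`, the bound `4 C_a` is at least `2 / a(1)`; for `μ_a ≥ 1` it is at least the
    -- Hardy constant `4 / a(1)`.
    have h4 : 1 / 2 ≤ min 4 (1 / (2 - mu a)) :=
      le_min (by norm_num) (one_div_le_one_div_of_le h2 (by linarith [ha.mu_nonneg]))
    calc ‖u.toL2‖ ^ 2 ≤ 4 * (1 / a 1 * (1 / 2)) * ‖u‖ ^ 2 := by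
          refine h3.trans (le_of_eq ?_); ring
      _ ≤ _ := by gcongr
  · have h4 : 1 ≤ min 4 (1 / (2 - mu a)) :=
      le_min (by norm_num) (by rw [le_div_iff₀ h2]; linarith)
    calc ‖u.toL2‖ ^ 2 ≤ 4 * (1 / a 1 * 1) * ‖u‖ ^ 2 := by
          refine u.norm_toL2_sq_le_hardy.trans (le_of_eq ?_); ring
      _ ≤ _ := by gcongr

lemma norm_toL2_le (u : H1 ha) : ‖u.toL2‖ ≤ 2 * √(poincareConst a) * ‖u‖ := by
  refine abs_le_of_sq_le_sq' ?_ (by positivity) |>.2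
  rw [mul_pow, mul_pow, Real.sq_sqrt (poincareConst_nonneg ha)]
  refine u.norm_toL2_sq_le.trans (le_of_eq ?_)
  ring

/-- The inclusion `H¹_a(0,1) → L²(0,1)` as a bounded operator. -/
noncomputable def toL2L (ha : IsDegenerateCoeff a) : H1 ha →L[ℝ] L2 :=
  LinearMap.mkContinuous H1.toL2 (2 * √(poincareConst a)) norm_toL2_le

@[simp] lemma toL2L_apply (u : H1 ha) : toL2L ha u = u.toL2 := rfl

/-- The isometry `u ↦ √a u'` as a bounded operator. -/
noncomputable def gradL (ha : IsDegenerateCoeff a) : H1 ha →L[ℝ] L2 :=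
  LinearMap.mkContinuous H1.grad 1 fun u => by rw [one_mul, norm_eq_grad]

@[simp] lemma gradL_apply (u : H1 ha) : gradL ha u = u.grad := rfl

end H1

/-! ### Cauchy-Schwarz inequalities -/

lemma integrable_fun_mul {p q : ℝ → ℝ} (hp : MemLp p 2 vol01) (hq : MemLp q 2 vol01) :
    Integrable (fun x => p x * q x) vol01 :=
  hp.integrable_mul hq

lemma sq_integral_mul_le {p q : ℝ → ℝ} (hp : MemLp p 2 vol01) (hq : MemLp q 2 vol01) :
    (∫ x, p x * q x ∂vol01) ^ 2 ≤ (∫ x, p x ^ 2 ∂vol01) * ∫ x, q x ^ 2 ∂vol01 := by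
  rw [← inner_eq_integral hp.coeFn_toLp hq.coeFn_toLp, ← norm_sq_eq_integral hp.coeFn_toLp,
    ← norm_sq_eq_integral hq.coeFn_toLp, ← mul_pow, ← sq_abs]
  gcongr
  exact abs_real_inner_le_norm _ _

lemma sq_intervalIntegral_le {q : ℝ → ℝ} (hq : MemLp q 2 vol01) {x : ℝ}
    (hx : x ∈ Ioo (0 : ℝ) 1) : (∫ y in (0 : ℝ)..x, q y) ^ 2 ≤ x * ∫ y, q y ^ 2 ∂vol01 := by
  have hp : MemLp ((Ioo 0 x).indicator (fun _ => (1 : ℝ))) 2 vol01 :=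
    (memLp_const 1).indicator measurableSet_Ioo
  have hs : Ioo 0 x ∩ Ioo (0 : ℝ) 1 = Ioo 0 x :=
    inter_eq_left.2 (Ioo_subset_Ioo_right hx.2.le)
  have h := sq_integral_mul_le hp hq
  have h1 : ∫ y, (Ioo 0 x).indicator (fun _ => (1 : ℝ)) y * q y ∂vol01
      = ∫ y in (0 : ℝ)..x, q y := by
    rw [intervalIntegral.integral_of_le hx.1.le, integral_Ioc_eq_integral_Ioo]
    simp_rw [← indicator_mul_left, one_mul]
    rw [integral_indicator measurableSet_Ioo, Measure.restrict_restrict measurableSet_Ioo, hs]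
  have h2 : ∫ y, (Ioo 0 x).indicator (fun _ => (1 : ℝ)) y ^ 2 ∂vol01 = x := by
    have : ∀ y, (Ioo 0 x).indicator (fun _ => (1 : ℝ)) y ^ 2
        = (Ioo 0 x).indicator (fun _ => (1 : ℝ)) y := by
      intro y
      by_cases hy : y ∈ Ioo 0 x <;> simp [hy]
    simp_rw [this]
    rw [integral_indicator measurableSet_Ioo, Measure.restrict_restrict measurableSet_Ioo, hs]
    simp [hx.1.le]
  rwa [h1, h2] at h

/-! ### The flux `a u'` -/

/-- `g` is the absolutely continuous representative of the flux `a u'`, and `(a u')' = w`. -/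
structure IsFlux (u : H1 ha) (w : L2) (g : ℝ → ℝ) : Prop where
  ac : AbsolutelyContinuousOnInterval g 0 1
  ae_eq : (fun x => a x * deriv u.rep x) =ᵐ[vol01] g
  deriv_ae_eq : w =ᵐ[vol01] deriv g

lemma hasFluxDeriv_iff {u : H1 ha} {w : L2} : HasFluxDeriv u w ↔ ∃ g, IsFlux u w g :=
  ⟨fun ⟨g, h1, h2, h3⟩ => ⟨g, h1, h2, h3⟩, fun ⟨g, h⟩ => ⟨g, h.ac, h.ae_eq, h.deriv_ae_eq⟩⟩

lemma memLp_sqrt (ha : IsDegenerateCoeff a) : MemLp (fun x => √(a x)) 2 vol01 := by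
  obtain ⟨C, hC⟩ := isCompact_Icc.exists_bound_of_continuousOn ha.continuousOn.sqrt
  refine MemLp.of_bound ?_ C (ae_vol01 fun x hx => hC x (Ioo_subset_Icc_self hx))
  exact (ha.continuousOn.sqrt.mono Ioo_subset_Icc_self).aestronglyMeasurable measurableSet_Ioo

lemma memLp_id : MemLp (fun x : ℝ => x) 2 vol01 := by
  refine MemLp.of_bound aestronglyMeasurable_id 1 (ae_vol01 fun x hx => ?_)
  rw [Real.norm_eq_abs, abs_of_pos hx.1]
  exact hx.2.le

namespace IsFlux

variable {u : H1 ha} {w : L2} {g : ℝ → ℝ}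

lemma continuousOn (h : IsFlux u w g) : ContinuousOn g (Icc 0 1) := by
  have := h.ac.continuousOn
  rwa [uIcc_of_le zero_le_one] at this

lemma tendsto (h : IsFlux u w g) : Tendsto g (𝓝[>] 0) (𝓝 (g 0)) :=
  (h.continuousOn 0 ⟨le_rfl, zero_le_one⟩).mono_left
    (nhdsWithin_le_iff.2 (Icc_mem_nhdsGT zero_lt_one))

lemma locAC (h : IsFlux u w g) : LocAC g := LocAC.of_ac h.ac

lemma memLp_deriv (h : IsFlux u w g) : MemLp (deriv g) 2 vol01 := memLp_of_ae_eq h.deriv_ae_eq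

/-- With `a ≤ K x`, `g² / x = a² u'² / x ≤ K a u'²` is integrable, so the limit of `g²` at `0` must
vanish. The boundary condition of the strongly degenerate case is thus built into the domain. -/
lemma eq_zero (h : IsFlux u w g) (hmu : 1 ≤ mu a) : g 0 = 0 := by
  obtain ⟨K, hK⟩ := ha.exists_le_mul hmu
  refine pow_eq_zero_iff two_ne_zero |>.1 (LocAC.eq_zero_of_integrable_div (h.tendsto.pow 2) ?_)
  have hm : AEStronglyMeasurable (fun x => g x ^ 2 / x) vol01 := by
    refine ContinuousOn.aestronglyMeasurable ?_ measurableSet_Ioo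
    exact ((h.continuousOn.mono Ioo_subset_Icc_self).pow 2).div continuousOn_id
      fun x hx => hx.1.ne'
  refine (u.isH1_rep.memLp_deriv.integrable_sq.const_mul K).mono' hm ?_
  filter_upwards [h.ae_eq, ae_restrict_mem measurableSet_Ioo] with x h1 hx
  have hpos := ha.pos x ⟨hx.1, hx.2.le⟩
  rw [← h1, mul_pow, mul_pow, Real.sq_sqrt hpos.le, Real.norm_of_nonneg
    (div_nonneg (by positivity) hx.1.le), div_le_iff₀ hx.1]
  have := mul_le_mul_of_nonneg_right (hK x ⟨hx.1, hx.2.le⟩)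
    (mul_nonneg hpos.le (sq_nonneg (deriv u.rep x)))
  linarith

lemma sq_le (h : IsFlux u w g) (hmu : 1 ≤ mu a) {x : ℝ} (hx : x ∈ Ioo (0 : ℝ) 1) :
    g x ^ 2 ≤ x * ‖w‖ ^ 2 := by
  have h1 : ∫ y in (0 : ℝ)..x, deriv g y = g x := by
    rw [AbsolutelyContinuousOnInterval.integral_deriv_eq_sub, h.eq_zero hmu, sub_zero]
    refine h.ac.mono ?_
    rw [uIcc_of_le zero_le_one, uIcc_of_le hx.1.le]
    exact Icc_subset_Icc_right hx.2.le
  rw [norm_sq_eq_integral h.deriv_ae_eq, ← h1]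
  exact sq_intervalIntegral_le h.memLp_deriv hx

/-- This is the boundary term at `0` in Green's formula. For `μ_a < 1` the factor `v` vanishes at
`0`; otherwise `v² g² ≤ ‖w‖² x v²`, and `x v²` tends to `0`. -/
lemma tendsto_mul (h : IsFlux u w g) (v : H1 ha) :
    Tendsto (fun x => v.rep x * g x) (𝓝[>] 0) (𝓝 0) := by
  rcases lt_or_ge (mu a) 1 with hmu | hmu
  · simpa using (v.isH1_rep.at_zero hmu).mul h.tendsto
  · have h1 : Tendsto (fun x => (v.rep x * g x) ^ 2) (𝓝[>] 0) (𝓝 0) := by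
      have h2 := (v.isH1_rep.toIsV1.tendsto_mul_sq ha).const_mul (‖w‖ ^ 2)
      rw [mul_zero] at h2
      refine squeeze_zero' (Eventually.of_forall fun x => sq_nonneg _) ?_ h2
      filter_upwards [Ioo_mem_nhdsGT zero_lt_one] with x hx
      have := mul_le_mul_of_nonneg_left (h.sq_le hmu hx) (sq_nonneg (v.rep x))
      rw [mul_pow]
      linarith
    have h3 := h1.sqrt
    simp only [Real.sqrt_sq_eq_abs, Real.sqrt_zero] at h3
    exact (tendsto_zero_iff_abs_tendsto_zero _).2 h3

/-- Green's formula. -/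
lemma inner_toL2 (h : IsFlux u w g) (v : H1 ha) :
    inner ℝ v.toL2 w = -inner ℝ v.grad u.grad := by
  have i1 := integrable_fun_mul v.isH1_rep.memLp_deriv u.isH1_rep.memLp_deriv
  have i2 := integrable_fun_mul v.isH1_rep.memLp h.memLp_deriv
  have hφ : deriv (fun x => v.rep x * g x) =ᵐ[vol01] fun x =>
      √(a x) * deriv v.rep x * (√(a x) * deriv u.rep x) + v.rep x * deriv g x := by
    filter_upwards [LocAC.ae_hasDerivAt v.isH1_rep.ac, h.locAC.ae_hasDerivAt, h.ae_eq,
      ae_restrict_mem measurableSet_Ioo] with x h1 h2 h3 hx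
    have := Real.mul_self_sqrt (ha.pos x ⟨hx.1, hx.2.le⟩).le
    rw [(h1.fun_mul h2).deriv, ← h3]
    linear_combination (-deriv v.rep x * deriv u.rep x) * this
  have key := (LocAC.mul v.isH1_rep.ac h.locAC).integral_eq_of_tendsto hφ (i1.add i2)
    (h.tendsto_mul v)
  rw [integral_add i1 i2, v.isH1_rep.at_one, zero_mul] at key
  rw [inner_eq_integral v.toL2_ae_eq h.deriv_ae_eq, inner_eq_integral v.grad_ae_eq u.grad_ae_eq]
  linarith

lemma deriv_ae_eq_div (h : IsFlux u w g) : deriv u.rep =ᵐ[vol01] fun x => g x / a x := by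
  filter_upwards [h.ae_eq, ae_restrict_mem measurableSet_Ioo] with x h1 hx
  rw [← h1, mul_div_cancel_left₀ _ (ha.pos x ⟨hx.1, hx.2.le⟩).ne']

/-- On `]0,1]` the representative of `u` is the primitive of `g / a` from `1`, and `g / a` is
continuous up to `1`. -/
lemma mul_normalDeriv (h : IsFlux u w g) : a 1 * u.normalDeriv = g 1 := by
  have h1 : ContinuousOn (fun x => g x / a x) (Ioc 0 1) :=
    (h.continuousOn.mono Ioc_subset_Icc_self).div ha.continuousOn_Ioc
      fun x hx => (ha.pos x hx).ne'
  have h01 : (1 : ℝ) ∈ Ioc (0 : ℝ) 1 := ⟨one_pos, le_rfl⟩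
  have h2 : HasDerivWithinAt (fun x => ∫ y in (1 : ℝ)..x, g y / a y) (g 1 / a 1) (Iic 1) 1 := by
    refine intervalIntegral.integral_hasDerivWithinAt_right (t := Iic 1) (by simp) ?_ ?_
    · have := h1.stronglyMeasurableAtFilter_nhdsWithin (μ := volume) measurableSet_Ioc 1
      rwa [nhdsWithin_Ioc_eq_nhdsLE one_pos] at this
    · have := h1 1 h01
      rwa [ContinuousWithinAt, nhdsWithin_Ioc_eq_nhdsLE one_pos] at this
  have h3 : HasDerivWithinAt u.rep (g 1 / a 1) (Ioc 0 1) 1 := by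
    refine (h2.mono Ioc_subset_Iic_self).congr (fun x hx => ?_) ?_
    · rw [intervalIntegral.integral_symm]
      rcases hx.2.eq_or_lt with rfl | hx1
      · simp [u.isH1_rep.at_one]
      · rw [LocAC.integral_eq_sub u.isH1_rep.ac h.deriv_ae_eq_div ⟨hx.1, hx1⟩,
          u.isH1_rep.at_one]
        ring
    · simp [u.isH1_rep.at_one]
  rw [H1.normalDeriv, h3.derivWithin ((uniqueDiffOn_Ioc 0 1) 1 h01),
    mul_div_cancel₀ _ ha.pos_one.ne']

/-- Integrating `(x g)' = a u' + x w` expresses the trace through bounded functionals of `√a u'` and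
`w`. Its linearity and its continuity in time follow from this. -/
lemma mul_normalDeriv_eq_inner (h : IsFlux u w g) :
    a 1 * u.normalDeriv =
      inner ℝ ((memLp_sqrt ha).toLp _) u.grad + inner ℝ (memLp_id.toLp _) w := by
  have i1 := integrable_fun_mul (memLp_sqrt ha) u.isH1_rep.memLp_deriv
  have i2 := integrable_fun_mul memLp_id h.memLp_deriv
  have hφ : deriv (fun x => x * g x) =ᵐ[vol01] fun x =>
      √(a x) * (√(a x) * deriv u.rep x) + x * deriv g x := by
    filter_upwards [h.locAC.ae_hasDerivAt, h.ae_eq, ae_restrict_mem measurableSet_Ioo]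
      with x h2 h3 hx
    have := Real.mul_self_sqrt (ha.pos x ⟨hx.1, hx.2.le⟩).le
    rw [((hasDerivAt_id' x).fun_mul h2).deriv, ← h3]
    linear_combination (-deriv u.rep x) * this
  have h0 : Tendsto (fun x => x * g x) (𝓝[>] 0) (𝓝 0) := by
    have : Tendsto (fun x : ℝ => x) (𝓝[>] 0) (𝓝 0) := tendsto_id.mono_left nhdsWithin_le_nhds
    simpa using this.mul h.tendsto
  have key := ((LocAC.of_contDiff contDiff_fun_id).mul h.locAC).integral_eq_of_tendsto hφ
    (i1.add i2) h0
  rw [integral_add i1 i2, one_mul] at key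
  rw [h.mul_normalDeriv, inner_eq_integral (memLp_sqrt ha).coeFn_toLp u.grad_ae_eq,
    inner_eq_integral memLp_id.coeFn_toLp h.deriv_ae_eq]
  exact key.symm

/-- The multiplier identity for `x u'`, with the bounds `1 - μ_a ≤ 1 - x a' / a ≤ 3`. -/
lemma multiplier_bounds (h : IsFlux u w g) :
    (1 - mu a) * ‖u‖ ^ 2 ≤ a 1 * u.normalDeriv ^ 2 - 2 * inner ℝ (weightMul ha u.grad) w ∧
      a 1 * u.normalDeriv ^ 2 - 2 * inner ℝ (weightMul ha u.grad) w ≤ 3 * ‖u‖ ^ 2 := by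
  have hN := u.isH1_rep.memLp_deriv.integrable_sq
  have hb : ∀ x ∈ Ioo (0 : ℝ) 1, |x * deriv a x * (a x)⁻¹| ≤ mu a := fun x hx => by
    have hpos := ha.pos x ⟨hx.1, hx.2.le⟩
    rw [abs_mul, abs_mul, abs_of_pos hx.1, abs_of_pos (inv_pos.2 hpos), ← div_eq_mul_inv,
      div_le_iff₀ hpos]
    exact ha.mul_abs_deriv_le hx
  have hm : AEStronglyMeasurable (fun x => x * deriv a x * (a x)⁻¹) vol01 := by
    refine (aestronglyMeasurable_id.mul (measurable_deriv a).aestronglyMeasurable).mul ?_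
    exact ((ha.continuousOn_Ioc.inv₀ fun x hx => (ha.pos x hx).ne').mono
      Ioo_subset_Ioc_self).aestronglyMeasurable measurableSet_Ioo
  have i1 : Integrable (fun x => (1 - x * deriv a x * (a x)⁻¹) * (√(a x) * deriv u.rep x) ^ 2)
      vol01 := by
    refine hN.bdd_mul (c := 1 + mu a) (aestronglyMeasurable_const.sub hm)
      (ae_vol01 fun x hx => (norm_sub_le _ _).trans ?_)
    rw [norm_one]
    exact add_le_add le_rfl (hb x hx)
  have i2 := (integrable_fun_mul (u.isH1_rep.toIsV1.memLp_mul_deriv ha) h.memLp_deriv).const_mul 2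
  have hφ : deriv (fun x => x * (a x)⁻¹ * g x ^ 2) =ᵐ[vol01] fun x =>
      (1 - x * deriv a x * (a x)⁻¹) * (√(a x) * deriv u.rep x) ^ 2
        + 2 * (x * deriv u.rep x * deriv g x) := by
    filter_upwards [h.locAC.ae_hasDerivAt, h.ae_eq, ae_restrict_mem measurableSet_Ioo]
      with x h2 h3 hx
    have hpos := ha.pos x ⟨hx.1, hx.2.le⟩
    have h4 := (ha.hasDerivAt hx).fun_inv hpos.ne'
    rw [(((hasDerivAt_id' x).fun_mul h4).fun_mul (h2.fun_pow 2)).deriv, ← h3,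
      mul_pow (√(a x)), Real.sq_sqrt hpos.le]
    have := hpos.ne'
    simp
    field_simp
    ring
  have hac : LocAC (fun x => x * (a x)⁻¹ * g x ^ 2) :=
    ((LocAC.of_contDiff contDiff_fun_id).mul fun ε hε => ha.ac_inv hε).mul h.locAC.sq
  -- After division by `x` the boundary term is `g² / a = a u'²`, the integrable energy density.
  have hdiv : Integrable (fun x => x * (a x)⁻¹ * g x ^ 2 / x) vol01 := by
    refine hN.congr ?_
    filter_upwards [h.ae_eq, ae_restrict_mem measurableSet_Ioo] with x h3 hx
    have hpos := ha.pos x ⟨hx.1, hx.2.le⟩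
    rw [← h3, mul_pow, Real.sq_sqrt hpos.le]
    have := hpos.ne'
    have := hx.1.ne'
    field_simp
  have key := hac.integral_eq hφ (i1.add i2) hdiv
  rw [integral_add i1 i2, integral_const_mul, ← h.mul_normalDeriv,
    ← inner_eq_integral u.weightMul_grad_ae_eq h.deriv_ae_eq] at key
  have h5 : 1 * (a 1)⁻¹ * (a 1 * u.normalDeriv) ^ 2 = a 1 * u.normalDeriv ^ 2 := by
    have := ha.pos_one.ne'
    field_simp
  rw [h5] at key
  have hQ : a 1 * u.normalDeriv ^ 2 - 2 * inner ℝ (weightMul ha u.grad) w =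
      ∫ x, (1 - x * deriv a x * (a x)⁻¹) * (√(a x) * deriv u.rep x) ^ 2 ∂vol01 := by
    linarith
  rw [hQ, H1.norm_eq_grad, norm_sq_eq_integral u.grad_ae_eq, ← integral_const_mul,
    ← integral_const_mul]
  constructor
  · refine integral_mono_ae (hN.const_mul _) i1 (ae_vol01 fun x hx => ?_)
    have := (abs_le.1 (hb x hx)).2
    exact mul_le_mul_of_nonneg_right (by linarith) (sq_nonneg _)
  · refine integral_mono_ae i1 (hN.const_mul _) (ae_vol01 fun x hx => ?_)
    have := (abs_le.1 (hb x hx)).1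
    exact mul_le_mul_of_nonneg_right (by linarith [ha.mu_lt_two]) (sq_nonneg _)

end IsFlux

/-! ### Completeness of `H¹_a(0,1)` -/

/-- The primitive of `h / √a` that vanishes at `1`. -/
noncomputable def prim (a : ℝ → ℝ) (h : L2) (x : ℝ) : ℝ :=
  ∫ y in (1 : ℝ)..x, (√(a y))⁻¹ * h y

lemma memLp_indicator_inv_sqrt (ha : IsDegenerateCoeff a) {x : ℝ} (hx : x ∈ Ioo (0 : ℝ) 1) :
    MemLp ((Ioo x 1).indicator fun y => (√(a y))⁻¹) 2 vol01 := by
  have hs : Icc x 1 ⊆ Ioc (0 : ℝ) 1 := fun y hy => ⟨hx.1.trans_le hy.1, hy.2⟩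
  obtain ⟨C, hC⟩ := isCompact_Icc.exists_bound_of_continuousOn (ha.continuousOn_inv_sqrt.mono hs)
  refine MemLp.of_bound ((measurable_inv_sqrt ha).indicator measurableSet_Ioo) C
    (ae_of_all _ fun y => ?_)
  by_cases hy : y ∈ Ioo x 1
  · rw [indicator_of_mem hy]
    exact hC y (Ioo_subset_Icc_self hy)
  · rw [indicator_of_notMem hy, norm_zero]
    exact (norm_nonneg _).trans (hC 1 ⟨hx.2.le, le_rfl⟩)

lemma setIntegral_inv_sqrt_mul {x : ℝ} (hx : x ∈ Ioo (0 : ℝ) 1) (h : L2) :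
    ∫ y, (Ioo x 1).indicator (fun y => (√(a y))⁻¹) y * h y ∂vol01 = -prim a h x := by
  have hs : Ioo x 1 ∩ Ioo (0 : ℝ) 1 = Ioo x 1 := inter_eq_left.2 (Ioo_subset_Ioo_left hx.1.le)
  rw [prim, intervalIntegral.integral_symm, intervalIntegral.integral_of_le hx.2.le,
    integral_Ioc_eq_integral_Ioo, neg_neg]
  simp_rw [← indicator_mul_left]
  rw [integral_indicator measurableSet_Ioo, Measure.restrict_restrict measurableSet_Ioo, hs]

lemma intervalIntegrable_inv_sqrt_mul (ha : IsDegenerateCoeff a) (h : L2) {x : ℝ}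
    (hx : x ∈ Ioo (0 : ℝ) 1) :
    IntervalIntegrable (fun y => (√(a y))⁻¹ * h y) volume x 1 := by
  have h1 := integrable_fun_mul (memLp_indicator_inv_sqrt ha hx) (Lp.memLp h)
  rw [intervalIntegrable_iff_integrableOn_Ioo_of_le hx.2.le]
  refine IntegrableOn.congr_fun (IntegrableOn.mono_set h1 (Ioo_subset_Ioo_left hx.1.le)) ?_
    measurableSet_Ioo
  intro y hy
  simp only [indicator_of_mem hy]

lemma prim_sub (ha : IsDegenerateCoeff a) (h k : L2) {x : ℝ} (hx : x ∈ Ioo (0 : ℝ) 1) :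
    prim a (h - k) x = prim a h x - prim a k x := by
  have key : ∀ k : L2, prim a k x =
      -∫ y, (Ioo x 1).indicator (fun y => (√(a y))⁻¹) y * k y ∂vol01 := fun k => by
    rw [setIntegral_inv_sqrt_mul hx, neg_neg]
  have hi := memLp_indicator_inv_sqrt ha hx
  rw [key, key, key, sub_neg_eq_add, neg_add_eq_sub, ← integral_sub
    (integrable_fun_mul hi (Lp.memLp k)) (integrable_fun_mul hi (Lp.memLp h)), ← integral_neg]
  refine integral_congr_ae ?_
  filter_upwards [Lp.coeFn_sub h k] with y hy
  rw [hy, Pi.sub_apply]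
  ring

lemma sq_prim_le (ha : IsDegenerateCoeff a) (h : L2) {x : ℝ} (hx : x ∈ Ioo (0 : ℝ) 1) :
    prim a h x ^ 2 ≤
      (∫ y, ((Ioo x 1).indicator (fun y => (√(a y))⁻¹) y) ^ 2 ∂vol01) * ‖h‖ ^ 2 := by
  have h1 := sq_integral_mul_le (memLp_indicator_inv_sqrt ha hx) (Lp.memLp h)
  rwa [setIntegral_inv_sqrt_mul hx, neg_sq, ← norm_sq_eq_integral (EventuallyEq.refl _ _)] at h1

/-- Away from `0` the weight `1 / √a` is bounded, so Cauchy-Schwarz turns `L²` convergence of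
gradients into pointwise convergence of primitives. -/
lemma tendsto_prim (ha : IsDegenerateCoeff a) {h : ℕ → L2} {k : L2}
    (hk : Tendsto h atTop (𝓝 k)) {x : ℝ} (hx : x ∈ Ioo (0 : ℝ) 1) :
    Tendsto (fun n => prim a (h n) x) atTop (𝓝 (prim a k x)) := by
  rw [← tendsto_sub_nhds_zero_iff]
  have h2 := ((tendsto_iff_norm_sub_tendsto_zero.1 hk).pow 2).const_mul
    (∫ y, ((Ioo x 1).indicator (fun y => (√(a y))⁻¹) y) ^ 2 ∂vol01)
  rw [zero_pow two_ne_zero, mul_zero] at h2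
  have h3 := (squeeze_zero (fun n => sq_nonneg _)
    (fun n => sq_prim_le ha (h n - k) hx) h2).sqrt
  simp only [Real.sqrt_sq_eq_abs, Real.sqrt_zero] at h3
  refine ((tendsto_zero_iff_abs_tendsto_zero _).2 h3).congr fun n => ?_
  rw [prim_sub ha _ _ hx]

lemma memLp_inv_sqrt (ha : IsDegenerateCoeff a) (hmu : mu a < 1) :
    MemLp (fun x => (√(a x))⁻¹) 2 vol01 := by
  refine (memLp_two_iff_integrable_sq (measurable_inv_sqrt ha)).2 ?_
  have h1 : IntegrableOn (fun x : ℝ => x ^ (-mu a)) (Ioo 0 1) := by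
    rw [← intervalIntegrable_iff_integrableOn_Ioo_of_le zero_le_one]
    exact intervalIntegral.intervalIntegrable_rpow' (by linarith)
  refine (h1.const_mul (a 1)⁻¹).mono' ((measurable_inv_sqrt ha).pow 2) (ae_vol01 fun x hx => ?_)
  have hx' : x ∈ Ioc (0 : ℝ) 1 := ⟨hx.1, hx.2.le⟩
  rw [inv_pow, Real.sq_sqrt (ha.pos x hx').le, Real.norm_of_nonneg
    (inv_nonneg.2 (ha.pos x hx').le), Real.rpow_neg hx.1.le, ← mul_inv]
  exact inv_anti₀ (mul_pos ha.pos_one (Real.rpow_pos_of_pos hx.1 _)) (ha.rpow_le hx')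

/-- For `μ_a < 1`, `1 / a` is integrable on `]0,1[`, so the bound is uniform in `x`. This lets the
condition `u(0) = 0` pass to limits. -/
lemma sq_prim_le_of_mu_lt_one (ha : IsDegenerateCoeff a) (hmu : mu a < 1) (h : L2) {x : ℝ}
    (hx : x ∈ Ioo (0 : ℝ) 1) :
    prim a h x ^ 2 ≤ (∫ y, (√(a y))⁻¹ ^ 2 ∂vol01) * ‖h‖ ^ 2 := by
  refine (sq_prim_le ha h hx).trans (mul_le_mul_of_nonneg_right ?_ (sq_nonneg _))
  refine integral_mono (memLp_indicator_inv_sqrt ha hx).integrable_sq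
    (memLp_inv_sqrt ha hmu).integrable_sq fun y => ?_
  by_cases hy : y ∈ Ioo x 1
  · simp [indicator_of_mem hy]
  · simp only [indicator_of_notMem hy, zero_pow two_ne_zero]
    exact sq_nonneg _

lemma locAC_prim (ha : IsDegenerateCoeff a) (h : L2) : LocAC (prim a h) := fun _ hε =>
  (intervalIntegrable_inv_sqrt_mul ha h hε).absolutelyContinuousOnInterval_intervalIntegral
    right_mem_uIcc

lemma deriv_prim (ha : IsDegenerateCoeff a) (h : L2) :
    (fun x => √(a x) * deriv (prim a h) x) =ᵐ[vol01] h := by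
  -- The intervals `[1/(n+2), 1]` exhaust `]0,1]`; the shift by `2` keeps their left ends below `1`.
  have h1 : ∀ n : ℕ, ∀ᵐ x : ℝ, x ∈ uIcc (1 / ((n : ℝ) + 2)) 1 →
      HasDerivAt (prim a h) ((√(a x))⁻¹ * h x) x := by
    intro n
    have hn : 1 / ((n : ℝ) + 2) ∈ Ioo (0 : ℝ) 1 := by
      refine ⟨by positivity, ?_⟩
      rw [div_lt_one (by positivity)]
      linarith [n.cast_nonneg (α := ℝ)]
    filter_upwards [(intervalIntegrable_inv_sqrt_mul ha h hn).ae_hasDerivAt_integral] with x hx hx2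
    exact hx hx2 1 right_mem_uIcc
  have h2 := ae_restrict_of_ae (s := Ioo (0 : ℝ) 1) (ae_all_iff.2 h1)
  filter_upwards [h2, ae_restrict_mem measurableSet_Ioo] with x hx hx01
  obtain ⟨n, hn⟩ := exists_nat_one_div_lt hx01.1
  have h3 : 1 / ((n : ℝ) + 2) ≤ 1 / ((n : ℝ) + 1) := by
    apply one_div_le_one_div_of_le <;> [positivity; linarith]
  rw [(hx n (mem_uIcc_of_le (h3.trans hn.le) hx01.2.le)).deriv,
    mul_inv_cancel_left₀ (Real.sqrt_pos.2 (ha.pos x ⟨hx01.1, hx01.2.le⟩)).ne']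

namespace H1

lemma rep_eq_prim (u : H1 ha) {x : ℝ} (hx : x ∈ Ioo (0 : ℝ) 1) : u.rep x = prim a u.grad x := by
  have h1 : deriv u.rep =ᵐ[vol01] fun x => (√(a x))⁻¹ * u.grad x := by
    filter_upwards [u.grad_ae_eq, ae_restrict_mem measurableSet_Ioo] with x h2 hx
    rw [h2, inv_mul_cancel_left₀ (Real.sqrt_pos.2 (ha.pos x ⟨hx.1, hx.2.le⟩)).ne']
  rw [prim, intervalIntegral.integral_symm, LocAC.integral_eq_sub u.isH1_rep.ac h1 hx,
    u.isH1_rep.at_one]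
  ring

/-- The gradients of a Cauchy sequence converge to some `k` in `L²(0,1)`, and its terms converge in
`L²(0,1)` by the Poincaré inequality. Pointwise convergence of the representatives identifies the
limit as the primitive of `k / √a` vanishing at `1`. -/
instance : CompleteSpace (H1 ha) := by
  refine Metric.complete_of_cauchySeq_tendsto fun u hu => ?_
  obtain ⟨k, hk⟩ := cauchySeq_tendsto_of_complete
    ((gradL ha).uniformContinuous.comp_cauchySeq hu)
  obtain ⟨z, hz⟩ := cauchySeq_tendsto_of_complete
    ((toL2L ha).uniformContinuous.comp_cauchySeq hu)
  have hzk : z =ᵐ[vol01] prim a k := by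
    obtain ⟨ns, hns, hlim⟩ := (tendstoInMeasure_of_tendsto_Lp hz).exists_seq_tendsto_ae
    have hrep : ∀ᵐ x ∂vol01, ∀ n, (toL2L ha (u n)) x = (u n).rep x :=
      ae_all_iff.2 fun n => (u n).toL2_ae_eq
    filter_upwards [hlim, hrep, ae_restrict_mem measurableSet_Ioo] with x h1 h2 hx
    refine tendsto_nhds_unique h1 (((tendsto_prim ha hk hx).comp hns.tendsto_atTop).congr ?_)
    intro n
    simp only [Function.comp_apply, gradL_apply, h2, rep_eq_prim _ hx]
  have hH1 : IsH1 a (prim a k) := by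
    refine ⟨⟨memLp_of_ae_eq hzk, locAC_prim ha k,
      (memLp_congr_ae (deriv_prim ha k)).2 (Lp.memLp k)⟩, by simp [prim], fun hmu => ?_⟩
    have hunif : TendstoUniformlyOnFilter (fun n => (u n).rep) (prim a k) atTop (𝓝[>] 0) := by
      refine (TendstoUniformlyOn.tendstoUniformlyOnFilter (s := Ioo 0 1) ?_).mono_right
        (le_principal_iff.2 (Ioo_mem_nhdsGT zero_lt_one))
      rw [Metric.tendstoUniformlyOn_iff]
      intro ε hε
      have h2 := ((tendsto_iff_norm_sub_tendsto_zero.1 hk).pow 2).const_mul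
        (∫ y, (√(a y))⁻¹ ^ 2 ∂vol01)
      rw [zero_pow two_ne_zero, mul_zero] at h2
      filter_upwards [h2.eventually_lt_const (show 0 < ε ^ 2 by positivity)] with n hn x hx
      rw [rep_eq_prim _ hx, dist_comm, Real.dist_eq, ← prim_sub ha _ _ hx]
      refine abs_lt_of_sq_lt_sq ((sq_prim_le_of_mu_lt_one ha hmu _ hx).trans_lt hn) hε.le
    exact hunif.tendsto_of_eventually_tendsto
      (Eventually.of_forall fun n => (u n).isH1_rep.at_zero hmu) tendsto_const_nhds
  let U : H1 ha := ⟨z, prim a k, hzk, hH1⟩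
  have hU : U.grad = k := by
    refine Lp.ext (U.grad_ae_eq.trans (EventuallyEq.trans ?_ (deriv_prim ha k)))
    refine ae_vol01 fun x hx => ?_
    simp only [U.deriv_rep_eq hH1.toIsV1 hzk hx]
  refine ⟨U, ?_⟩
  rw [tendsto_iff_norm_sub_tendsto_zero] at hk ⊢
  refine hk.congr fun n => ?_
  rw [norm_eq_grad, map_sub, hU]
  rfl

end H1

/-! ### Contraction semigroups -/

section Semigroup

variable {X : Type*} [NormedAddCommGroup X] [NormedSpace ℝ X] {S : ℝ → X →L[ℝ] X}
  {G : X → X → Prop}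

namespace IsContractionSemigroup

lemma norm_apply_le (hS : IsContractionSemigroup S) {t : ℝ} (ht : 0 ≤ t) (x : X) :
    ‖S t x‖ ≤ ‖x‖ :=
  ((S t).le_of_opNorm_le (hS.norm_le t ht) x).trans (one_mul _).le

lemma zero_apply (hS : IsContractionSemigroup S) (x : X) : S 0 x = x := by
  rw [hS.zero]
  rfl

lemma add_apply (hS : IsContractionSemigroup S) {s t : ℝ} (hs : 0 ≤ s) (ht : 0 ≤ t) (x : X) :
    S (s + t) x = S s (S t x) := by
  rw [hS.add s t hs ht]
  rfl

lemma comm_apply (hS : IsContractionSemigroup S) {s t : ℝ} (hs : 0 ≤ s) (ht : 0 ≤ t) (x : X) :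
    S s (S t x) = S t (S s x) := by
  rw [← hS.add_apply hs ht, ← hS.add_apply ht hs, add_comm]

lemma norm_sub_le (hS : IsContractionSemigroup S) {s t : ℝ} (hs : 0 ≤ s) (ht : 0 ≤ t) (x : X) :
    ‖S t x - S s x‖ ≤ ‖S |t - s| x - x‖ := by
  wlog hst : s ≤ t generalizing s t
  · rw [norm_sub_rev, abs_sub_comm]
    exact this ht hs (le_of_not_ge hst)
  have h : S t x - S s x = S s (S (t - s) x - x) := by
    rw [map_sub, ← hS.add_apply hs (sub_nonneg.2 hst), add_sub_cancel]
  rw [h, abs_of_nonneg (sub_nonneg.2 hst)]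
  exact hS.norm_apply_le hs _

lemma continuousOn (hS : IsContractionSemigroup S) (x : X) :
    ContinuousOn (fun t => S t x) (Ici 0) := by
  have h0 : Tendsto (fun r => ‖S r x - x‖) (𝓝[≥] 0) (𝓝 0) := by
    rw [← tendsto_iff_norm_sub_tendsto_zero, ← Ioi_insert, nhdsWithin_insert, tendsto_sup]
    refine ⟨?_, hS.tendsto x⟩
    rw [tendsto_pure_left]
    intro s hs
    rw [hS.zero_apply]
    exact mem_of_mem_nhds hs
  intro s hs
  rw [ContinuousWithinAt, tendsto_iff_norm_sub_tendsto_zero]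
  have h2 : Tendsto (fun t => |t - s|) (𝓝[Ici 0] s) (𝓝[≥] 0) := by
    refine tendsto_nhdsWithin_iff.2 ⟨?_, Eventually.of_forall fun t => mem_Ici.2 (abs_nonneg _)⟩
    have : Continuous fun t => |t - s| := by fun_prop
    simpa using (this.tendsto s).mono_left nhdsWithin_le_nhds
  refine squeeze_zero' (Eventually.of_forall fun _ => norm_nonneg _) ?_ (h0.comp h2)
  filter_upwards [self_mem_nhdsWithin] with t ht
  exact hS.norm_sub_le hs ht x

lemma generator_apply (hS : IsContractionSemigroup S) (hG : IsGenerator S G) {x y : X}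
    (h : G x y) {t : ℝ} (ht : 0 ≤ t) : G (S t x) (S t y) := by
  rw [hG]
  refine (((S t).continuous.tendsto y).comp ((hG x y).1 h)).congr' ?_
  filter_upwards [self_mem_nhdsWithin] with r hr
  simp only [Function.comp_apply, map_smul, map_sub, hS.comm_apply ht (le_of_lt hr)]

lemma hasDerivWithinAt_Ioi (hS : IsContractionSemigroup S) (hG : IsGenerator S G) {x y : X}
    (h : G x y) {t : ℝ} (ht : 0 ≤ t) :
    HasDerivWithinAt (fun s => S s x) (S t y) (Ioi t) t := by
  rw [hasDerivWithinAt_iff_tendsto_slope' self_notMem_Ioi]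
  have h1 := (hG _ _).1 (hS.generator_apply hG h ht)
  have h2 : Tendsto (fun s => s - t) (𝓝[>] t) (𝓝[>] 0) := by
    refine tendsto_nhdsWithin_iff.2 ⟨?_, ?_⟩
    · have : Continuous fun s : ℝ => s - t := by fun_prop
      simpa using (this.tendsto t).mono_left nhdsWithin_le_nhds
    · filter_upwards [self_mem_nhdsWithin] with s hs using mem_Ioi.2 (sub_pos.2 (mem_Ioi.1 hs))
  refine (h1.comp h2).congr' ?_
  filter_upwards [self_mem_nhdsWithin] with s hs
  rw [Function.comp_apply, ← hS.add_apply (sub_nonneg.2 (le_of_lt hs)) ht, sub_add_cancel,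
    slope_def_module]

lemma intervalIntegrable (hS : IsContractionSemigroup S) (x : X) {s t : ℝ} (hs : 0 ≤ s)
    (ht : 0 ≤ t) : IntervalIntegrable (fun r => S r x) volume s t := by
  refine ((hS.continuousOn x).mono ?_).intervalIntegrable
  exact fun r hr => (le_min hs ht).trans hr.1

variable [CompleteSpace X]

lemma integral_eq_sub (hS : IsContractionSemigroup S) (hG : IsGenerator S G) {x y : X}
    (h : G x y) {t : ℝ} (ht : 0 ≤ t) : ∫ s in (0 : ℝ)..t, S s y = S t x - x := by
  have := intervalIntegral.integral_eq_sub_of_hasDeriv_right_of_le ht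
    ((hS.continuousOn x).mono Icc_subset_Ici_self)
    (fun s hs => hS.hasDerivWithinAt_Ioi hG h hs.1.le) (hS.intervalIntegrable y le_rfl ht)
  rwa [hS.zero_apply] at this

lemma hasDerivWithinAt_integral_Icc (hS : IsContractionSemigroup S) (y : X) {T t : ℝ}
    (ht : t ∈ Icc 0 T) :
    HasDerivWithinAt (fun r => ∫ s in (0 : ℝ)..r, S s y) (S t y) (Icc 0 T) t := by
  have := Fact.mk ht
  have hc := (hS.continuousOn y).mono (Icc_subset_Ici_self : Icc 0 T ⊆ Ici 0)
  exact intervalIntegral.integral_hasDerivWithinAt_right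
    (hS.intervalIntegrable y le_rfl ht.1)
    (hc.stronglyMeasurableAtFilter_nhdsWithin measurableSet_Icc t) (hc t ht)

lemma hasDerivWithinAt_integral (hS : IsContractionSemigroup S) (y : X) {t : ℝ} (ht : 0 ≤ t) :
    HasDerivWithinAt (fun r => ∫ s in (0 : ℝ)..r, S s y) (S t y) (Ici 0) t := by
  refine (hS.hasDerivWithinAt_integral_Icc y (T := t + 1)
    ⟨ht, by linarith⟩).mono_of_mem_nhdsWithin ?_
  rw [← Ici_inter_Iic]
  exact inter_mem_nhdsWithin _ (Iic_mem_nhds (by linarith))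

/-- The generator yields only right derivatives. Integrating them gives `S t x = x + ∫₀ᵗ S s y`,
whose integrand is continuous, hence differentiability from both sides. -/
lemma hasDerivWithinAt (hS : IsContractionSemigroup S) (hG : IsGenerator S G) {x y : X}
    (h : G x y) {t : ℝ} (ht : 0 ≤ t) :
    HasDerivWithinAt (fun s => S s x) (S t y) (Ici 0) t := by
  refine ((hS.hasDerivWithinAt_integral y ht).add_const x).congr (fun s hs => ?_) ?_
  · rw [hS.integral_eq_sub hG h hs, sub_add_cancel]
  · rw [hS.integral_eq_sub hG h ht, sub_add_cancel]

lemma generator_integral (hS : IsContractionSemigroup S) (hG : IsGenerator S G) (x : X) {t : ℝ}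
    (ht : 0 ≤ t) : G (∫ s in (0 : ℝ)..t, S s x) (S t x - x) := by
  rw [hG]
  have hslope : ∀ t : ℝ, 0 ≤ t → Tendsto (fun r : ℝ =>
      r⁻¹ • ((∫ s in (0 : ℝ)..t + r, S s x) - ∫ s in (0 : ℝ)..t, S s x)) (𝓝[>] 0)
      (𝓝 (S t x)) := by
    intro t ht
    have h1 := (hS.hasDerivWithinAt_integral x ht).mono
      (fun s hs => ht.trans (le_of_lt hs) : Ioi t ⊆ Ici 0)
    rw [hasDerivWithinAt_iff_tendsto_slope' self_notMem_Ioi] at h1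
    have h2 : Tendsto (fun r => t + r) (𝓝[>] 0) (𝓝[>] t) := by
      refine tendsto_nhdsWithin_iff.2 ⟨?_, ?_⟩
      · have : Continuous fun s : ℝ => t + s := by fun_prop
        simpa using (this.tendsto 0).mono_left nhdsWithin_le_nhds
      · filter_upwards [self_mem_nhdsWithin] with s hs using mem_Ioi.2 (lt_add_of_pos_right t (mem_Ioi.1 hs))
    refine (h1.comp h2).congr fun r => ?_
    rw [Function.comp_apply, slope_def_module, add_sub_cancel_left]
  have h0 := (hslope t ht).sub (hslope 0 le_rfl)
  rw [hS.zero_apply] at h0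
  refine h0.congr' ?_
  filter_upwards [self_mem_nhdsWithin] with r hr
  have hr0 : (0 : ℝ) ≤ r := le_of_lt hr
  have i1 := hS.intervalIntegrable x le_rfl ht
  -- The semigroup law shifts the interval, so the increment is the integral over `[t, t+r]` minus
  -- the one over `[0, r]`; divided by `r`, these tend to `S t x` and `x`.
  have h1 : S r (∫ s in (0 : ℝ)..t, S s x) = ∫ s in r..t + r, S s x := by
    rw [← (S r).intervalIntegral_comp_comm i1]
    have : ∫ s in (0 : ℝ)..t, S r (S s x) = ∫ s in (0 : ℝ)..t, S (s + r) x := by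
      refine intervalIntegral.integral_congr fun s hs => ?_
      rw [uIcc_of_le ht] at hs
      simp only [add_comm s r, hS.add_apply hr0 hs.1]
    rw [this, intervalIntegral.integral_comp_add_right (fun s => S s x), zero_add]
  have h2 := intervalIntegral.integral_add_adjacent_intervals
    (hS.intervalIntegrable x le_rfl hr0) (hS.intervalIntegrable x hr0 (add_nonneg ht hr0))
  rw [h1, ← h2, ← smul_sub, zero_add, intervalIntegral.integral_same, sub_zero]
  congr 1
  abel

/-- The domain of the generator is dense. -/
lemma exists_generator_dist_lt (hS : IsContractionSemigroup S) (hG : IsGenerator S G) (x : X)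
    {ε : ℝ} (hε : 0 < ε) : ∃ p y, G p y ∧ ‖p - x‖ < ε := by
  have h1 := (hS.hasDerivWithinAt_integral x le_rfl).mono (Ioi_subset_Ici_self (a := 0))
  rw [hasDerivWithinAt_iff_tendsto_slope' self_notMem_Ioi, hS.zero_apply] at h1
  have h2 := (tendsto_iff_norm_sub_tendsto_zero.1 h1).eventually_lt_const hε
  obtain ⟨t, ht, ht0⟩ := (h2.and self_mem_nhdsWithin).exists
  rw [slope_def_module, sub_zero, intervalIntegral.integral_same, sub_zero] at ht
  refine ⟨_, t⁻¹ • (S t x - x), ?_, ht⟩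
  have h3 := (hG _ _).1 (hS.generator_integral hG x (le_of_lt ht0))
  rw [hG]
  refine (h3.const_smul t⁻¹).congr fun r => ?_
  rw [map_smul, ← smul_sub, smul_comm]

end IsContractionSemigroup

end Semigroup

/-! ### The semigroup of the wave equation on the domain of its generator -/

lemma norm_sq_energySpace (U : EnergySpace ha) : ‖U‖ ^ 2 = ‖U.fst‖ ^ 2 + ‖U.snd‖ ^ 2 :=
  WithLp.prod_norm_sq_eq_of_L2 U

/-- `(a u'(1))`, as a bounded functional of `U = (u,v)` and `AU`. -/
lemma WaveOp.mul_normalDeriv_eq {U W : EnergySpace ha} (h : WaveOp ha U W) :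
    a 1 * U.fst.normalDeriv = inner ℝ ((memLp_sqrt ha).toLp _) (H1.gradL ha U.fst) +
      inner ℝ (memLp_id.toLp _) W.snd := by
  obtain ⟨g, hg⟩ := hasFluxDeriv_iff.1 h.2
  exact hg.mul_normalDeriv_eq_inner

/-- The operator `A` is skew-symmetric. -/
lemma WaveOp.inner_eq_zero {U W : EnergySpace ha} (h : WaveOp ha U W) : inner ℝ U W = 0 := by
  obtain ⟨g, hg⟩ := hasFluxDeriv_iff.1 h.2
  rw [WithLp.prod_inner_apply]
  change inner ℝ U.fst W.fst + inner ℝ U.snd W.snd = 0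
  rw [h.1, hg.inner_toL2, H1.inner_eq_grad, real_inner_comm]
  ring

/-- The functional `2 ∫ x u' v` on the energy space. -/
noncomputable def multiplierForm (U : EnergySpace ha) : ℝ :=
  2 * inner ℝ (weightMul ha (H1.gradL ha U.fst)) U.snd

/-- The functional `∫ u v` on the energy space. -/
noncomputable def productForm (U : EnergySpace ha) : ℝ :=
  inner ℝ (H1.toL2L ha U.fst) U.snd

lemma abs_multiplierForm_le (U : EnergySpace ha) :
    |multiplierForm U| ≤ 1 / min 1 (a 1) * ‖U‖ ^ 2 := by
  have h1 := abs_real_inner_le_norm (weightMul ha (H1.gradL ha U.fst)) U.snd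
  have h2 := norm_weightMul_le ha (H1.gradL ha U.fst)
  rw [H1.gradL_apply, ← H1.norm_eq_grad] at h2
  have hm : 0 < min 1 (a 1) := lt_min one_pos ha.pos_one
  have h3 : 1 / a 1 ≤ 1 / min 1 (a 1) := one_div_le_one_div_of_le hm (min_le_right _ _)
  have h4 : 1 ≤ 1 / min 1 (a 1) := by rw [le_div_iff₀ hm, one_mul]; exact min_le_left _ _
  rw [norm_sq_energySpace, multiplierForm, abs_mul, abs_two, mul_add]
  have h5 := mul_le_mul_of_nonneg_right h3 (sq_nonneg ‖U.fst‖)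
  have h6 := mul_le_mul_of_nonneg_right h4 (sq_nonneg ‖U.snd‖)
  rw [H1.gradL_apply] at h1 ⊢
  nlinarith [sq_nonneg (‖weightMul ha U.fst.grad‖ - ‖U.snd‖)]

lemma abs_productForm_le (U : EnergySpace ha) :
    |productForm U| ≤ √(poincareConst a) * ‖U‖ ^ 2 := by
  have h1 := abs_real_inner_le_norm (H1.toL2L ha U.fst) U.snd
  have h2 := H1.norm_toL2_le U.fst
  rw [norm_sq_energySpace, productForm]
  calc |inner ℝ (H1.toL2L ha U.fst) U.snd| ≤ ‖U.fst.toL2‖ * ‖U.snd‖ := h1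
    _ ≤ 2 * √(poincareConst a) * ‖U.fst‖ * ‖U.snd‖ := by gcongr
    _ = √(poincareConst a) * (2 * ‖U.fst‖ * ‖U.snd‖) := by ring
    _ ≤ _ := by
      gcongr
      exact two_mul_le_add_sq _ _

/-! ### Time derivatives along orbits in the domain -/

section

variable {S : ℝ → EnergySpace ha →L[ℝ] EnergySpace ha}

/-- Linearity of the graph is read off from the difference quotients of `S`. -/
lemma waveOp_sub (hG : IsGenerator S (WaveOp ha)) {U W U' W' : EnergySpace ha}
    (h : WaveOp ha U W) (h' : WaveOp ha U' W') : WaveOp ha (U - U') (W - W') := by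
  rw [hG] at *
  refine (h.sub h').congr fun r => ?_
  rw [← smul_sub, map_sub]
  congr 1
  abel

variable {P W : EnergySpace ha} (hS : IsContractionSemigroup S)
  (hG : IsGenerator S (WaveOp ha)) (h : WaveOp ha P W)

include hS hG h

lemma continuousOn_normalDeriv :
    ContinuousOn (fun t => (S t P).fst.normalDeriv) (Ici 0) := by
  have h1 : ContinuousOn (fun t => (a 1)⁻¹ * (inner ℝ ((memLp_sqrt ha).toLp _)
      (H1.gradL ha (S t P).fst) + inner ℝ (memLp_id.toLp _) (S t W).snd)) (Ici 0) := by
    have c1 := (WithLp.fstL 2 ℝ (H1 ha) L2).continuous.comp_continuousOn (hS.continuousOn P)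
    have c2 := (WithLp.sndL 2 ℝ (H1 ha) L2).continuous.comp_continuousOn (hS.continuousOn W)
    exact continuousOn_const.mul ((ContinuousOn.inner continuousOn_const
      ((H1.gradL ha).continuous.comp_continuousOn c1)).add (ContinuousOn.inner continuousOn_const c2))
  refine h1.congr fun t ht => ?_
  simp only [← WaveOp.mul_normalDeriv_eq (hS.generator_apply hG h ht)]
  rw [inv_mul_cancel_left₀ ha.pos_one.ne']

lemma hasDerivWithinAt_fst {t : ℝ} (ht : 0 ≤ t) :
    HasDerivWithinAt (fun s => (S s P).fst) (S t W).fst (Ici 0) t :=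
  (WithLp.fstL 2 ℝ (H1 ha) L2).hasFDerivAt.comp_hasDerivWithinAt t (hS.hasDerivWithinAt hG h ht)

lemma hasDerivWithinAt_snd {t : ℝ} (ht : 0 ≤ t) :
    HasDerivWithinAt (fun s => (S s P).snd) (S t W).snd (Ici 0) t :=
  (WithLp.sndL 2 ℝ (H1 ha) L2).hasFDerivAt.comp_hasDerivWithinAt t (hS.hasDerivWithinAt hG h ht)

/-- By the product rule; the term `2 ∫ x v' v`, with `v = u_t` in `H¹_a`, equals `-∫ v²`. -/
lemma hasDerivWithinAt_multiplierForm {t : ℝ} (ht : 0 ≤ t) :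
    HasDerivWithinAt (fun s => multiplierForm (S s P))
      (2 * inner ℝ (weightMul ha (H1.gradL ha (S t P).fst)) (S t W).snd - ‖(S t P).snd‖ ^ 2)
      (Ici 0) t := by
  have d1 := (weightMul ha ∘L H1.gradL ha).hasFDerivAt.comp_hasDerivWithinAt t
    (hasDerivWithinAt_fst hS hG h ht)
  have d2 := (d1.inner ℝ (hasDerivWithinAt_snd hS hG h ht)).const_mul 2
  refine d2.congr_deriv ?_
  have h1 := (S t W).fst.two_inner_weightMul_grad
  rw [← (hS.generator_apply hG h ht).1] at h1
  simp only [Function.comp_apply, ContinuousLinearMap.comp_apply, H1.gradL_apply] at *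
  linarith

lemma hasDerivWithinAt_productForm {t : ℝ} (ht : 0 ≤ t) :
    HasDerivWithinAt (fun s => productForm (S s P))
      (‖(S t P).snd‖ ^ 2 - ‖(S t P).fst‖ ^ 2) (Ici 0) t := by
  have d1 := (H1.toL2L ha).hasFDerivAt.comp_hasDerivWithinAt t (hasDerivWithinAt_fst hS hG h ht)
  refine (d1.inner ℝ (hasDerivWithinAt_snd hS hG h ht)).congr_deriv ?_
  have h2 := hS.generator_apply hG h ht
  obtain ⟨g, hg⟩ := hasFluxDeriv_iff.1 h2.2
  simp only [Function.comp_apply, H1.toL2L_apply, ← h2.1]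
  rw [hg.inner_toL2, real_inner_self_eq_norm_sq, real_inner_self_eq_norm_sq, ← H1.norm_eq_grad]
  ring

/-- Conservation of energy: the derivative is twice the scalar product of `S t P` with its image
under the skew-symmetric `A`. -/
lemma norm_sq_eq {t : ℝ} (ht : 0 ≤ t) : ‖S t P‖ ^ 2 = ‖P‖ ^ 2 := by
  have hc : ContinuousOn (fun s => ‖S s P‖ ^ 2) (Icc 0 t) :=
    ((hS.continuousOn P).mono Icc_subset_Ici_self).norm.pow 2
  have := constant_of_has_deriv_right_zero hc (fun s hs => ?_) t ⟨ht, le_rfl⟩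
  · rwa [hS.zero_apply] at this
  · have d := (hS.hasDerivWithinAt hG h hs.1).norm_sq
    rw [(hS.generator_apply hG h hs.1).inner_eq_zero, mul_zero] at d
    exact d.mono (Ici_subset_Ici.2 hs.1)

end

/-! ### Inequalities for the normal derivative of classical solutions -/

section

variable {S : ℝ → EnergySpace ha →L[ℝ] EnergySpace ha} {P W : EnergySpace ha}
  (hS : IsContractionSemigroup S) (hG : IsGenerator S (WaveOp ha)) (h : WaveOp ha P W)

include hS hG h

lemma integrableOn_normalDeriv_sq (T : ℝ) :
    IntegrableOn (fun t => a 1 * (S t P).fst.normalDeriv ^ 2) (Icc 0 T) := by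
  have h1 := (continuousOn_normalDeriv hS hG h).mono (Icc_subset_Ici_self : Icc 0 T ⊆ Ici 0)
  exact (continuousOn_const.mul (h1.pow 2)).integrableOn_Icc

/-- The inverse inequality for classical solutions. -/
lemma observability_classical {T : ℝ} (hT : 0 ≤ T) :
    ((2 - mu a) * T - 4 / min 1 (a 1) - 2 * mu a * √(poincareConst a)) * (1 / 2 * ‖P‖ ^ 2) ≤
      a 1 * ∫ t in (0 : ℝ)..T, (S t P).fst.normalDeriv ^ 2 := by
  rw [← intervalIntegral.integral_const_mul]
  -- The weight `μ_a / 2` is chosen so that, with `‖P‖² = ‖u‖² + ‖u_t‖²`, the terms in `‖u_t‖²`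
  -- cancel and `(1 - μ_a) ‖u‖² + 2 ∫ x u' w` remains, which is at most `a(1) u_x(1)²`.
  have hd : ∀ t : ℝ, 0 ≤ t → HasDerivWithinAt (fun t => multiplierForm (S t P) +
      mu a / 2 * productForm (S t P) + (1 - mu a / 2) * ‖P‖ ^ 2 * t) _ (Ici 0) t := fun t ht =>
    ((hasDerivWithinAt_multiplierForm hS hG h ht).fun_add
      ((hasDerivWithinAt_productForm hS hG h ht).const_mul (mu a / 2))).fun_add
      ((hasDerivWithinAt_id t (Ici 0)).const_mul ((1 - mu a / 2) * ‖P‖ ^ 2))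
  have key := intervalIntegral.sub_le_integral_of_hasDeriv_right_of_le hT
    (fun t ht => (hd t ht.1).continuousWithinAt.mono Icc_subset_Ici_self)
    (fun t ht => (hd t ht.1.le).mono fun s hs => ht.1.le.trans (le_of_lt hs))
    (integrableOn_normalDeriv_sq hS hG h T) (fun t ht => by
      have ht0 := ht.1.le
      obtain ⟨g, hg⟩ := hasFluxDeriv_iff.1 (hS.generator_apply hG h ht0).2
      have h1 := hg.multiplier_bounds.1
      have h2 := norm_sq_eq hS hG h ht0
      rw [norm_sq_energySpace] at h2
      rw [← h2, H1.gradL_apply]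
      linarith)
  refine le_trans ?_ key
  simp only [hS.zero_apply]
  have hm := ha.mu_nonneg
  have e := norm_sq_eq hS hG h hT
  have b1 := (abs_le.1 (abs_multiplierForm_le (S T P))).1
  have b2 := (abs_le.1 (abs_multiplierForm_le P)).2
  have b3 := mul_le_mul_of_nonneg_left (abs_le.1 (abs_productForm_le (S T P))).1 hm
  have b4 := mul_le_mul_of_nonneg_left (abs_le.1 (abs_productForm_le P)).2 hm
  rw [e] at b1 b3
  rw [show 4 / min 1 (a 1) = 4 * (1 / min 1 (a 1)) by ring]
  linarith

/-- The direct inequality for classical solutions. -/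
lemma hidden_regularity_classical {T : ℝ} (hT : 0 ≤ T) :
    a 1 * ∫ t in (0 : ℝ)..T, (S t P).fst.normalDeriv ^ 2 ≤
      (3 * T + 2 / min 1 (a 1)) * ‖P‖ ^ 2 := by
  rw [← intervalIntegral.integral_const_mul]
  have hd : ∀ t : ℝ, 0 ≤ t → HasDerivWithinAt (fun t => multiplierForm (S t P) +
      3 * ‖P‖ ^ 2 * t) _ (Ici 0) t := fun t ht =>
    (hasDerivWithinAt_multiplierForm hS hG h ht).fun_add
      ((hasDerivWithinAt_id t (Ici 0)).const_mul (3 * ‖P‖ ^ 2))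
  have key := intervalIntegral.integral_le_sub_of_hasDeriv_right_of_le hT
    (fun t ht => (hd t ht.1).continuousWithinAt.mono Icc_subset_Ici_self)
    (fun t ht => (hd t ht.1.le).mono fun s hs => ht.1.le.trans (le_of_lt hs))
    (integrableOn_normalDeriv_sq hS hG h T) (fun t ht => by
      have ht0 := ht.1.le
      obtain ⟨g, hg⟩ := hasFluxDeriv_iff.1 (hS.generator_apply hG h ht0).2
      have h1 := hg.multiplier_bounds.2
      have h2 := norm_sq_eq hS hG h ht0
      rw [norm_sq_energySpace] at h2
      rw [← h2, H1.gradL_apply]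
      linarith [sq_nonneg ‖(S t P).snd‖])
  refine key.trans ?_
  simp only [hS.zero_apply]
  have e := norm_sq_eq hS hG h hT
  have b1 := (abs_le.1 (abs_multiplierForm_le (S T P))).2
  have b2 := (abs_le.1 (abs_multiplierForm_le P)).1
  rw [e] at b1
  rw [show 2 / min 1 (a 1) = 2 * (1 / min 1 (a 1)) by ring]
  linarith

lemma derivWithin_fst_toL2 {t : ℝ} (ht : 0 ≤ t) :
    HasDerivWithinAt (fun s => (S s P).fst.toL2) (S t P).snd (Ici 0) t := by
  rw [(hS.generator_apply hG h ht).1]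
  exact (H1.toL2L ha).hasFDerivAt.comp_hasDerivWithinAt t (hasDerivWithinAt_fst hS hG h ht)

/-- The orbits of the semigroup in the domain of its generator are classical solutions. -/
lemma isClassicalSolution_of_waveOp :
    IsClassicalSolution ha P.fst P.snd (fun t => (S t P).fst) := by
  have hd : ∀ t ∈ Ici (0 : ℝ), derivWithin (fun s => (S s P).fst.toL2) (Ici 0) t = (S t P).snd :=
    fun t ht => (derivWithin_fst_toL2 hS hG h ht).derivWithin (uniqueDiffOn_Ici 0 t ht)
  refine ⟨⟨?_, ?_, S, hS, hG, fun t ht => ?_⟩, W, h⟩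
  · rw [contDiffOn_one_iff_derivWithin (uniqueDiffOn_Ici 0)]
    refine ⟨fun t ht => (derivWithin_fst_toL2 hS hG h ht).differentiableWithinAt, ?_⟩
    exact ((WithLp.sndL 2 ℝ (H1 ha) L2).continuous.comp_continuousOn
      (hS.continuousOn P)).congr hd
  · exact (WithLp.fstL 2 ℝ (H1 ha) L2).continuous.comp_continuousOn (hS.continuousOn P)
  · rw [timeDeriv, hd t ht]
    rfl

end

lemma IsClassicalSolution.exists_semigroup {p : H1 ha} {q : L2} {v : ℝ → H1 ha}
    (hv : IsClassicalSolution ha p q v) :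
    ∃ (S : ℝ → EnergySpace ha →L[ℝ] EnergySpace ha) (W : EnergySpace ha),
      IsContractionSemigroup S ∧ IsGenerator S (WaveOp ha) ∧ WaveOp ha (WithLp.toLp 2 (p, q)) W ∧
      ∀ t : ℝ, 0 ≤ t → v t = (S t (WithLp.toLp 2 (p, q))).fst := by
  obtain ⟨⟨-, -, S, hS, hG, heq⟩, W, hW⟩ := hv
  exact ⟨S, W, hS, hG, hW, fun t ht => congrArg WithLp.fst (heq t ht)⟩

lemma IsMildSolution.energy_zero {u₀ : H1 ha} {u₁ : L2} {u : ℝ → H1 ha}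
    (hu : IsMildSolution ha u₀ u₁ u) : energy u 0 = 1 / 2 * (‖u₀‖ ^ 2 + ‖u₁‖ ^ 2) := by
  obtain ⟨S, hS, -, heq⟩ := hu.semigroup
  have h0 := heq 0 le_rfl
  rw [hS.zero_apply] at h0
  have h1 : u 0 = u₀ := congrArg WithLp.fst h0
  have h2 : timeDeriv u 0 = u₁ := congrArg WithLp.snd h0
  rw [energy, h1, h2, H1.norm_eq_grad, norm_sq_eq_integral u₀.grad_ae_eq,
    norm_sq_eq_integral (EventuallyEq.refl _ u₁),
    ← integral_add u₀.isH1_rep.memLp_deriv.integrable_sq (Lp.memLp u₁).integrable_sq]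
  congr 1
  refine integral_congr_ae (ae_vol01 fun x hx => ?_)
  simp only [mul_pow, Real.sq_sqrt (ha.pos x ⟨hx.1, hx.2.le⟩).le]
  ring

/-! ### Convergence in `L²` -/

section

variable {α : Type*} [MeasurableSpace α] {μ : Measure α} {f : α → ℝ}

lemma norm_toLp_two_sq (hf : MemLp f 2 μ) : ‖hf.toLp f‖ ^ 2 = ∫ x, f x ^ 2 ∂μ := by
  rw [← real_inner_self_eq_norm_sq, L2.inner_def]
  refine integral_congr_ae ?_
  filter_upwards [hf.coeFn_toLp] with x hx
  simp [hx, pow_two]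

lemma eLpNorm_two_le (hf : MemLp f 2 μ) {C : ℝ} (hC : 0 ≤ C) (h : ∫ x, f x ^ 2 ∂μ ≤ C ^ 2) :
    eLpNorm f 2 μ ≤ ENNReal.ofReal C := by
  rw [← ENNReal.ofReal_toReal hf.eLpNorm_ne_top, ← Lp.norm_toLp f hf]
  refine ENNReal.ofReal_le_ofReal (abs_le_of_sq_le_sq' ?_ hC).2
  rwa [norm_toLp_two_sq]

lemma tendsto_integral_sq {F : ℕ → α → ℝ} (hF : ∀ n, MemLp (F n) 2 μ) (hf : MemLp f 2 μ)
    (h : Tendsto (fun n => eLpNorm (fun x => F n x - f x) 2 μ) atTop (𝓝 0)) :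
    Tendsto (fun n => ∫ x, F n x ^ 2 ∂μ) atTop (𝓝 (∫ x, f x ^ 2 ∂μ)) := by
  have h1 := ((Lp.tendsto_Lp_iff_tendsto_eLpNorm'' F hF f hf).2 h).norm.pow 2
  simpa only [norm_toLp_two_sq] using h1

end

lemma memLp_of_continuousOn_Ici {f : ℝ → ℝ} (hf : ContinuousOn f (Ici 0)) (T : ℝ) :
    MemLp f 2 (volume.restrict (Ioc 0 T)) := by
  have h1 := hf.mono (Icc_subset_Ici_self : Icc 0 T ⊆ Ici 0)
  obtain ⟨C, hC⟩ := isCompact_Icc.exists_bound_of_continuousOn h1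
  refine MemLp.of_bound ((h1.mono Ioc_subset_Icc_self).aestronglyMeasurable measurableSet_Ioc) C ?_
  filter_upwards [ae_restrict_mem measurableSet_Ioc] with x hx
  exact hC x (Ioc_subset_Icc_self hx)

/-! ### The normal trace of mild solutions -/

lemma IsClassicalSolution.memLp_normalDeriv {p : H1 ha} {q : L2} {v : ℝ → H1 ha}
    (hv : IsClassicalSolution ha p q v) (T : ℝ) :
    MemLp (fun t => (v t).normalDeriv) 2 (volume.restrict (Ioc 0 T)) := by
  obtain ⟨S, W, hS, hG, hW, heq⟩ := hv.exists_semigroup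
  refine memLp_of_continuousOn_Ici ((continuousOn_normalDeriv hS hG hW).congr fun t ht => ?_) T
  simp only [heq t ht]

lemma IsClassicalSolution.observability {p : H1 ha} {q : L2} {v : ℝ → H1 ha}
    (hv : IsClassicalSolution ha p q v) {T : ℝ} (hT : 0 ≤ T) :
    ((2 - mu a) * T - 4 / min 1 (a 1) - 2 * mu a * √(poincareConst a)) *
      (1 / 2 * (‖p‖ ^ 2 + ‖q‖ ^ 2)) ≤
      a 1 * ∫ t in Ioc 0 T, (v t).normalDeriv ^ 2 := by
  obtain ⟨S, W, hS, hG, hW, heq⟩ := hv.exists_semigroup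
  have h1 := observability_classical hS hG hW hT
  rw [norm_sq_energySpace, intervalIntegral.integral_of_le hT] at h1
  refine h1.trans_eq ?_
  congr 1
  refine setIntegral_congr_fun measurableSet_Ioc fun t ht => ?_
  simp only [heq t ht.1.le]

/-- The observability inequality for mild solutions. -/
lemma IsNormalTrace.observability {u₀ : H1 ha} {u₁ : L2} {u : ℝ → H1 ha} {g : ℝ → ℝ}
    (hu : IsMildSolution ha u₀ u₁ u) (hg : IsNormalTrace ha u₀ u₁ g) {T : ℝ} (hT : 0 ≤ T) :
    ((2 - mu a) * T - 4 / min 1 (a 1) - 2 * mu a * √(poincareConst a)) * energy u 0 ≤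
      a 1 * ∫ t in (0 : ℝ)..T, g t ^ 2 := by
  obtain ⟨p, q, v, hv, hp, hq, hlim⟩ := hg.approx
  rw [hu.energy_zero, intervalIntegral.integral_of_le hT]
  refine le_of_tendsto_of_tendsto' ((((hp.norm.pow 2).add (hq.norm.pow 2)).const_mul _).const_mul _)
    ((tendsto_integral_sq (fun n => (hv n).memLp_normalDeriv T) (hg.memLp T hT)
      (hlim T hT)).const_mul (a 1)) fun n => (hv n).observability hT

lemma normalDeriv_sub {S : ℝ → EnergySpace ha →L[ℝ] EnergySpace ha}
    (hG : IsGenerator S (WaveOp ha)) {U W U' W' : EnergySpace ha}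
    (h : WaveOp ha U W) (h' : WaveOp ha U' W') :
    (U - U').fst.normalDeriv = U.fst.normalDeriv - U'.fst.normalDeriv := by
  refine mul_left_cancel₀ ha.pos_one.ne' ?_
  rw [mul_sub, h.mul_normalDeriv_eq, h'.mul_normalDeriv_eq,
    (waveOp_sub hG h h').mul_normalDeriv_eq, WithLp.sub_fst, WithLp.sub_snd, map_sub,
    inner_sub_right, inner_sub_right]
  ring

/-- The direct inequality for the difference of two orbits: on the domain, the trace is Lipschitz in
the initial data. -/
lemma eLpNorm_normalDeriv_sub_le {S : ℝ → EnergySpace ha →L[ℝ] EnergySpace ha}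
    (hS : IsContractionSemigroup S) (hG : IsGenerator S (WaveOp ha)) {P W P' W' : EnergySpace ha}
    (h : WaveOp ha P W) (h' : WaveOp ha P' W') {T : ℝ} (hT : 0 ≤ T) :
    eLpNorm ((fun t => (S t P).fst.normalDeriv) - fun t => (S t P').fst.normalDeriv) 2
      (volume.restrict (Ioc 0 T)) ≤
      ENNReal.ofReal (√((3 * T + 2 / min 1 (a 1)) / a 1) * ‖P - P'‖) := by
  have hm : 0 < min 1 (a 1) := lt_min one_pos ha.pos_one
  have hK : 0 ≤ (3 * T + 2 / min 1 (a 1)) / a 1 := div_nonneg (by positivity) ha.pos_one.le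
  refine eLpNorm_two_le ((memLp_of_continuousOn_Ici (continuousOn_normalDeriv hS hG h) T).sub
    (memLp_of_continuousOn_Ici (continuousOn_normalDeriv hS hG h') T)) (by positivity) ?_
  have h1 := hidden_regularity_classical hS hG (waveOp_sub hG h h') hT
  rw [intervalIntegral.integral_of_le hT] at h1
  rw [mul_pow, Real.sq_sqrt hK, div_mul_eq_mul_div, le_div_iff₀ ha.pos_one, mul_comm]
  refine le_trans (le_of_eq ?_) h1
  congr 1
  refine setIntegral_congr_fun measurableSet_Ioc fun t ht => ?_
  simp only [map_sub, Pi.sub_apply, normalDeriv_sub hG (hS.generator_apply hG h ht.1.le)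
    (hS.generator_apply hG h' ht.1.le)]

/-- Approximation at the rate `2^(-n)` makes the traces converge almost everywhere, not only in
`L²`. The pointwise limit is therefore a single function that serves every `T`. -/
lemma IsMildSolution.exists_isNormalTrace {u₀ : H1 ha} {u₁ : L2} {u : ℝ → H1 ha}
    (hu : IsMildSolution ha u₀ u₁ u) : ∃ g : ℝ → ℝ, IsNormalTrace ha u₀ u₁ g := by
  obtain ⟨S, hS, hG, -⟩ := hu.semigroup
  have hex : ∀ n : ℕ, ∃ p y, WaveOp ha p y ∧ ‖p - WithLp.toLp 2 (u₀, u₁)‖ < (1 / 2 : ℝ) ^ n :=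
    fun n => hS.exists_generator_dist_lt hG _ (by positivity)
  choose P W hPW hlt using hex
  have hP : Tendsto P atTop (𝓝 (WithLp.toLp 2 (u₀, u₁))) := by
    rw [tendsto_iff_norm_sub_tendsto_zero]
    exact squeeze_zero (fun n => norm_nonneg _) (fun n => (hlt n).le)
      (tendsto_pow_atTop_nhds_zero_of_lt_one (by norm_num) (by norm_num))
  let τ : ℕ → ℝ → ℝ := fun n t => (S t (P n)).fst.normalDeriv
  let g : ℝ → ℝ := fun t => limUnder atTop fun n => τ n t
  have hτ : ∀ n T, MemLp (τ n) 2 (volume.restrict (Ioc 0 T)) := fun n T =>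
    memLp_of_continuousOn_Ici (continuousOn_normalDeriv hS hG (hPW n)) T
  have hmain : ∀ T : ℝ, 0 ≤ T →
      (∀ᵐ t ∂volume.restrict (Ioc 0 T), Tendsto (fun n => τ n t) atTop (𝓝 (g t))) ∧
      Tendsto (fun n => eLpNorm (τ n - g) 2 (volume.restrict (Ioc 0 T))) atTop (𝓝 0) := by
    intro T hT
    set K := √((3 * T + 2 / min 1 (a 1)) / a 1)
    have hK : 0 ≤ K := Real.sqrt_nonneg _
    have hB : ∑' n : ℕ, ENNReal.ofReal ((K + 1) * 2 * (1 / 2 : ℝ) ^ n) ≠ ⊤ :=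
      (summable_geometric_two.mul_left _).tsum_ofReal_ne_top
    -- The factor `2` comes from the triangle inequality through the limit; `K + 1` in place of `K`
    -- keeps the inequality strict without needing `K > 0`.
    have hcau : ∀ N n m : ℕ, N ≤ n → N ≤ m → eLpNorm (τ n - τ m) 2 (volume.restrict (Ioc 0 T)) <
        ENNReal.ofReal ((K + 1) * 2 * (1 / 2 : ℝ) ^ N) := by
      intro N n m hn hm
      refine (eLpNorm_normalDeriv_sub_le hS hG (hPW n) (hPW m) hT).trans_lt ?_
      rw [ENNReal.ofReal_lt_ofReal_iff (by positivity)]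
      have hmono : ∀ k, N ≤ k → ‖P k - WithLp.toLp 2 (u₀, u₁)‖ < (1 / 2 : ℝ) ^ N := fun k hk =>
        (hlt k).trans_le (pow_le_pow_of_le_one (by norm_num) (by norm_num) hk)
      have h1 : ‖P n - P m‖ < 2 * (1 / 2 : ℝ) ^ N := by
        rw [← sub_sub_sub_cancel_right (P n) (P m) (WithLp.toLp 2 (u₀, u₁))]
        linarith [norm_sub_le (P n - WithLp.toLp 2 (u₀, u₁)) (P m - WithLp.toLp 2 (u₀, u₁)),
          hmono n hn, hmono m hm]
      calc K * ‖P n - P m‖ ≤ K * (2 * (1 / 2 : ℝ) ^ N) := by gcongr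
        _ < (K + 1) * 2 * (1 / 2 : ℝ) ^ N := by
          have : (0 : ℝ) < (1 / 2 : ℝ) ^ N := by positivity
          linarith
    have hmeas : ∀ n, AEStronglyMeasurable (τ n) (volume.restrict (Ioc 0 T)) := fun n =>
      (hτ n T).aestronglyMeasurable
    have hae : ∀ᵐ t ∂volume.restrict (Ioc 0 T), Tendsto (fun n => τ n t) atTop (𝓝 (g t)) := by
      filter_upwards [Lp.ae_tendsto_of_cauchy_eLpNorm hmeas (by norm_num) hB hcau] with t ht
      exact tendsto_nhds_limUnder ht
    exact ⟨hae, Lp.cauchy_tendsto_of_tendsto hmeas g hB hcau hae⟩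
  refine ⟨g, fun T hT => ?_, fun n => (P n).fst, fun n => (P n).snd, fun n t => (S t (P n)).fst,
    fun n => isClassicalSolution_of_waveOp hS hG (hPW n),
    ((WithLp.fstL 2 ℝ (H1 ha) L2).continuous.tendsto _).comp hP,
    ((WithLp.sndL 2 ℝ (H1 ha) L2).continuous.tendsto _).comp hP, fun T hT => (hmain T hT).2⟩
  obtain ⟨hae, hlim⟩ := hmain T hT
  obtain ⟨n, hn⟩ := (hlim.eventually_lt_const ENNReal.zero_lt_top).exists
  have hgm : AEStronglyMeasurable g (volume.restrict (Ioc 0 T)) :=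
    aestronglyMeasurable_of_tendsto_ae atTop (fun n => (hτ n T).aestronglyMeasurable) hae
  have h1 : MemLp (τ n - g) 2 (volume.restrict (Ioc 0 T)) :=
    ⟨(hτ n T).aestronglyMeasurable.sub hgm, hn⟩
  simpa using (hτ n T).sub h1

end DegWave

/-! ### The observability theorem -/

theorem mainTheorem1 (a : ℝ → ℝ) (ha : DegWave.IsDegenerateCoeff a) :
    (∀ (u₀ : DegWave.H1 ha) (u₁ : DegWave.L2) (u : ℝ → DegWave.H1 ha),
      DegWave.IsMildSolution ha u₀ u₁ u →
        (∃ g : ℝ → ℝ, DegWave.IsNormalTrace ha u₀ u₁ g) ∧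
        ∀ g : ℝ → ℝ, DegWave.IsNormalTrace ha u₀ u₁ g → ∀ T : ℝ, 0 ≤ T →
          a 1 * ∫ t in (0 : ℝ)..T, g t ^ 2 ≥
            ((2 - DegWave.mu a) * T - 4 / min 1 (a 1)
              - 2 * DegWave.mu a * √(DegWave.poincareConst a)) * DegWave.energy u 0) ∧
    (∀ T : ℝ, DegWave.observabilityTime a < T →
      DegWave.IsObservable ha T ∧
      ((1 / a 1 * ((2 - DegWave.mu a) * T - 4 / min 1 (a 1)
          - 2 * DegWave.mu a * √(DegWave.poincareConst a)) : ℝ) : EReal)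
        ≤ DegWave.observabilityConst ha T) := by
  refine ⟨fun u₀ u₁ u hu => ⟨hu.exists_isNormalTrace, fun g hg T hT => hg.observability hu hT⟩,
    fun T hT => ?_⟩
  have h1 := ha.pos_one
  have h2 : 0 < 2 - DegWave.mu a := by linarith [ha.mu_lt_two]
  have h3 : 0 < min 1 (a 1) := lt_min one_pos h1
  have h4 := ha.mu_nonneg
  have hT0 : 0 ≤ T := by
    refine le_trans ?_ hT.le
    unfold DegWave.observabilityTime
    positivity
  -- `T > T_a` says exactly that the bracket is positive, so that after division by `a(1)` it is
  -- itself an observability constant.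
  have hpos : 0 < (2 - DegWave.mu a) * T - 4 / min 1 (a 1)
      - 2 * DegWave.mu a * √(DegWave.poincareConst a) := by
    rw [DegWave.observabilityTime, one_div, inv_mul_lt_iff₀ h2] at hT
    linarith
  have hC : DegWave.IsObservabilityConstant ha T (1 / a 1 * ((2 - DegWave.mu a) * T
      - 4 / min 1 (a 1) - 2 * DegWave.mu a * √(DegWave.poincareConst a))) := by
    refine ⟨by positivity, fun u₀ u₁ u g hu hg => ?_⟩
    rw [mul_assoc, one_div, inv_mul_le_iff₀ h1]
    exact hg.observability hu hT0
  exact ⟨⟨_, hC⟩, le_sSup (Set.mem_image_of_mem _ hC)⟩
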